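/- Let $\beta\in(0,2)$. Let $X,Y$ be real-valued stochastic processes on $[0,1]$, defined on a common probability space, each of them jointly measurable, stochastically continuous and with almost surely bounded paths. Write $\|f\|_2=(\int_0^1 f(u)^2\,du)^{1/2}$, let $(X_i,Y_i)$, $i=1,2,3$, be iid copies of $(X,Y)$, and assume that $$E[\|X\|_2^\beta]+E[\|Y\|_2^\beta]<\infty,\quad E[\|X_1-X_2\|_2^\beta\|Y_1-Y_2\|_2^\beta]<\infty,\quad E[\|X_1-X_2\|_2^\beta\|Y_1-Y_3\|_2^\beta]<\infty .$$ Define the distance covariance $$T_\beta(X,Y)=E\big[\|X_1-X_2\|_2^\beta\|Y_1-Y_2\|_2^\beta\big]+E\big[\|X_1-X_2\|_2^\beta\big]\,E\big[\|Y_1-Y_2\|_2^\beta\big]-2\,E\big[\|X_1-X_2\|_2^\beta\|Y_1-Y_3\|_2^\beta\big].$$ Let $B_1,B_2$ be independent standard Brownian motions on $[0,1]$ such that $B=(B_1,B_2)$ is independent of $(X,Y)$, let $\mathcal F_B$ be the $\sigma$-field generated by $B$, and let $Y'$ be a copy of $Y$ (jointly measurable, stochastically continuous, with almost surely bounded paths,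 and with the same law as $Y$) which is independent of $(X,Y,B_1,B_2)$. Then $$c_0^2\,T_\beta(X,Y)=\int_{\mathbb R^2}|st|^{-(1+\beta)}\;E\Big|E\Big[e^{is\int_0^1 X\,dB_1}e^{it\int_0^1 Y\,dB_2}-e^{is\int_0^1 X\,dB_1}e^{it\int_0^1 Y'\,dB_2}\,\Big|\,\mathcal F_B\Big]\Big|^2\,ds\,dt,$$ where $$c_0=\int_{\mathbb R}\frac{1-e^{-s^2/2}}{|s|^{1+\beta}}\,ds ,$$ and the integrals over $\mathbb R^2$ and over $\mathbb R$ are finite. -/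

import Mathlib

open MeasureTheory ProbabilityTheory Filter Topology
open scoped ENNReal unitInterval

noncomputable section

namespace DistCov

variable {Ω : Type*}

/-- The sample path of a process `X` on `[0,1]` as a map from `Ω` into the product space
`ℝ^[0,1]`, which carries the product (cylinder) σ-field. -/
def path (X : I → Ω → ℝ) (ω : Ω) : I → ℝ := fun u ↦ X u ω

/-- The `L²[0,1]`-norm of a function on the unit interval. -/
def l2norm (f : I → ℝ) : ℝ := Real.sqrt (∫ u : I, (f u) ^ 2)

/-- The processes under consideration: (jointly) measurable, stochastically continuous, and
bounded (almost every sample path is bounded). -/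
structure IsAdmissible [MeasurableSpace Ω] (P : Measure Ω) (X : I → Ω → ℝ) : Prop where
  measurable : Measurable (fun z : I × Ω ↦ X z.1 z.2)
  stochContinuous : ∀ u : I, TendstoInMeasure P X (𝓝 u) (X u)
  bounded : ∀ᵐ ω ∂P, ∃ C : ℝ, ∀ u : I, |X u ω| ≤ C

/-- Standard Brownian motion on `[0,1]`: a centred Gaussian process with covariance `min u v`
and almost surely continuous paths. -/
structure IsBrownianUnit [MeasurableSpace Ω] (P : Measure Ω) (B : I → Ω → ℝ) : Prop where
  measurable : ∀ u : I, Measurable (B u)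
  gaussian : IsGaussianProcess B P
  mean : ∀ u : I, ∫ ω, B u ω ∂P = 0
  cov : ∀ u v : I, cov[B u, B v; P] = min (u : ℝ) (v : ℝ)
  continuous : ∀ᵐ ω ∂P, Continuous (fun u : I ↦ B u ω)

/-- A random step function `∑ i, ξ i 1_(a i, b i]` on `[0,1]` with finitely many terms and
`𝓖`-measurable coefficients. -/
structure StepProcess (𝓖 : MeasurableSpace Ω) where
  size : ℕ
  left : Fin size → I
  right : Fin size → I
  left_le_right : ∀ i, left i ≤ right i
  coeff : Fin size → Ω → ℝ
  measurable_coeff : ∀ i, Measurable[𝓖] (coeff i)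

/-- The value at time `u` of a step process. -/
def StepProcess.eval {𝓖 : MeasurableSpace Ω} (S : StepProcess 𝓖) (u : I) (ω : Ω) : ℝ :=
  ∑ i, S.coeff i ω * (Set.Ioc (S.left i) (S.right i)).indicator 1 u

/-- The elementary integral `∑ i, ξ i (B (b i) - B (a i))` of a step process. -/
def StepProcess.integral {𝓖 : MeasurableSpace Ω} (S : StepProcess 𝓖) (B : I → Ω → ℝ)
    (ω : Ω) : ℝ :=
  ∑ i, S.coeff i ω * (B (S.right i) ω - B (S.left i) ω)

/-- `Z` is a version of the stochastic integral `∫₀¹ X dB` of a process `X` that is independent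
of the Brownian motion `B`: `Z` is the limit in probability of elementary integrals of step
processes with `σ(X)`-measurable coefficients, which approximate `X` in the sense that
`∫₀¹ (Sₙ(u) - X(u))² du → 0` in probability. (This is the Itô integral for the filtration
`σ(X) ∨ σ(B u, u ≤ t)`, whose initial σ-field contains `σ(X)`.) -/
def IsStochIntegral [MeasurableSpace Ω] (P : Measure Ω) (X B : I → Ω → ℝ) (Z : Ω → ℝ) : Prop :=
  AEMeasurable Z P ∧
  ∃ S : ℕ → StepProcess (MeasurableSpace.comap (path X) inferInstance),
    (∀ ε : ℝ≥0∞, 0 < ε →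
      Tendsto (fun n ↦ P {ω | ε ≤ ∫⁻ u : I, ‖(S n).eval u ω - X u ω‖ₑ ^ 2}) atTop (𝓝 0)) ∧
    TendstoInMeasure P (fun n ↦ (S n).integral B) atTop Z

open Classical in
/-- The stochastic integral `∫₀¹ X dB` (defined up to almost sure equality). -/
def stochIntegral [MeasurableSpace Ω] (P : Measure Ω) (X B : I → Ω → ℝ) : Ω → ℝ :=
  if h : ∃ Z, IsStochIntegral P X B Z then h.choose else 0

/-- `‖X₁ - X₂‖₂`, where `X₁`, `X₂` are the copies of `X` evaluated at the sample points `ω₁`,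
`ω₂`; under a product measure these copies are iid. -/
def pathDist (X : I → Ω → ℝ) (ω₁ ω₂ : Ω) : ℝ := l2norm (fun u ↦ X u ω₁ - X u ω₂)

/-- The distance covariance
`E[‖X₁-X₂‖^β ‖Y₁-Y₂‖^β] + E[‖X₁-X₂‖^β] E[‖Y₁-Y₂‖^β] - 2 E[‖X₁-X₂‖^β ‖Y₁-Y₃‖^β]`, the iid copies
`(X₁,Y₁)`, `(X₂,Y₂)`, `(X₃,Y₃)` of `(X,Y)` being realized on products of the probability space. -/
def distCov [MeasurableSpace Ω] (P : Measure Ω) (β : ℝ) (X Y : I → Ω → ℝ) : ℝ :=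
  (∫ z : Ω × Ω, pathDist X z.1 z.2 ^ β * pathDist Y z.1 z.2 ^ β ∂(P.prod P))
  + (∫ z : Ω × Ω, pathDist X z.1 z.2 ^ β ∂(P.prod P))
      * (∫ z : Ω × Ω, pathDist Y z.1 z.2 ^ β ∂(P.prod P))
  - 2 * ∫ z : Ω × Ω × Ω, pathDist X z.1 z.2.1 ^ β * pathDist Y z.1 z.2.2 ^ β
      ∂(P.prod (P.prod P))

/-- The σ-field generated by the pair `(B₁, B₂)`. -/
abbrev sigmaB (B₁ B₂ : I → Ω → ℝ) : MeasurableSpace Ω :=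
  MeasurableSpace.comap (fun ω ↦ (path B₁ ω, path B₂ ω)) inferInstance

/-- The integrand `(1 - exp (-s²/2)) / |s|^(1+β)` of the constant `c₀`. -/
def c0Integrand (β s : ℝ) : ℝ := (1 - Real.exp (-(s ^ 2 / 2))) / |s| ^ (1 + β)

/-- The constant `c₀`. -/
def c0 (β : ℝ) : ℝ := ∫ s : ℝ, c0Integrand β s

/-- `exp(i s Z)` as a random variable. -/
def expi (s : ℝ) (Z : Ω → ℝ) (ω : Ω) : ℂ := Complex.exp (Complex.I * s * Z ω)

/-- `E | E[ exp(i s ∫X dB₁) exp(i t ∫Y dB₂) - exp(i s ∫X dB₁) exp(i t ∫Y' dB₂) | F_B ] |²`. -/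
def condDiffSq [MeasurableSpace Ω] (P : Measure Ω) (X Y Y' B₁ B₂ : I → Ω → ℝ) (s t : ℝ) : ℝ :=
  ∫ ω, ‖(P[fun ω ↦ expi s (stochIntegral P X B₁) ω * expi t (stochIntegral P Y B₂) ω
      - expi s (stochIntegral P X B₁) ω * expi t (stochIntegral P Y' B₂) ω
      | sigmaB B₁ B₂]) ω‖ ^ 2 ∂P

end DistCov

end

noncomputable section

/-! Conditioning on `B` freezes the Brownian paths and averages over `(X, Y, Y')`, which is
independent of `B`. The squared modulus of that average is an integral over two independent copies
of the triple. Interchanging this integral with the one over `B` leaves, for fixed integrands,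
characteristic functions of Wiener integrals such as `∫ (X₁ - X₂) dB₁`. Each such integral is
centred Gaussian with variance `‖X₁ - X₂‖²`, so it yields the kernel `g_s(r) = exp(-s² r² / 2)` at
`r = ‖X₁ - X₂‖`. Since `B₁` and `B₂` are independent, the kernels for `X` and `Y` multiply
(`condDiffSq_eq_integral`).

The four resulting terms are expectations of products of kernels over iid copies, combined exactly
as in the distance covariance. In that combination constants and terms in only one process cancel,
so every `g` may be replaced by `1 - g` (`condDiffSq_eq`). Substituting `s ↦ r s` gives `∫
|s|^(-(1+β)) (1 - g_s(r)) ds = c₀ r^β` (`integral_c0Kernel`). The integrands are now nonnegative, so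
the moment assumptions justify Fubini in each term (`integrable_and_integral_kernel_mul`).

The analytic work is to make the freezing legitimate. The stochastic integral is any limit in
probability of elementary integrals. It must be shown to exist (`exists_isStochIntegral`) and to be
a measurable functional of the two paths that is a Wiener integral for almost every frozen integrand
(`IsStochIntegral.exists_measurable`). -/

namespace DistCov

/-! ### Sample paths in `L²[0,1]` and their grid approximations -/

section

variable {Ω : Type*}

/-- The Hilbert space `L²[0,1]`. -/
abbrev L2I := Lp ℝ 2 (volume : Measure I)

instance : MeasurableSpace L2I := borel L2I
instance : BorelSpace L2I := ⟨rfl⟩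

instance : SecondCountableTopology L2I :=
  have : Fact ((2 : ℝ≥0∞) ≠ ∞) := ⟨by simp⟩
  inferInstance

/-- The indicator function of `(a, b]` as an element of `L²[0,1]`. -/
def ind (a b : I) : L2I :=
  indicatorConstLp 2 (measurableSet_Ioc (a := a) (b := b)) (measure_ne_top _ _) (1 : ℝ)

lemma coeFn_ind (a b : I) : ind a b =ᵐ[volume] (Set.Ioc a b).indicator 1 :=
  indicatorConstLp_coeFn

lemma coeFn_sum_smul_ind {ι : Type*} (s : Finset ι) (c : ι → ℝ) (a b : ι → I) :
    (∑ i ∈ s, c i • ind (a i) (b i) : L2I) =ᵐ[volume]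
      fun u ↦ ∑ i ∈ s, c i * (Set.Ioc (a i) (b i)).indicator 1 u := by
  classical
  induction s using Finset.induction_on with
  | empty => simpa using! Lp.coeFn_zero ℝ 2 (volume : Measure I)
  | insert i s hi ih =>
    rw [Finset.sum_insert hi]
    filter_upwards [Lp.coeFn_add (c i • ind (a i) (b i)) (∑ i ∈ s, c i • ind (a i) (b i)),
      Lp.coeFn_smul (c i) (ind (a i) (b i)), coeFn_ind (a i) (b i), ih] with u h1 h2 h3 h4
    rw [h1, Pi.add_apply, h2, Pi.smul_apply, h3, h4, Finset.sum_insert hi, smul_eq_mul]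

/-- The path at `ω` of a step process as an element of `L²[0,1]`. -/
def StepProcess.toL2 {𝓖 : MeasurableSpace Ω} (S : StepProcess 𝓖) (ω : Ω) : L2I :=
  ∑ i, S.coeff i ω • ind (S.left i) (S.right i)

lemma StepProcess.coeFn_toL2 {𝓖 : MeasurableSpace Ω} (S : StepProcess 𝓖) (ω : Ω) :
    S.toL2 ω =ᵐ[volume] fun u ↦ S.eval u ω :=
  coeFn_sum_smul_ind _ _ _ _

open Classical in
/-- The path of `X` at `ω` as an element of `L²[0,1]`, set to `0` if it is not square
integrable. -/
def pathLp (X : I → Ω → ℝ) (ω : Ω) : L2I :=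
  if h : MemLp (path X ω) 2 (volume : Measure I) then h.toLp _ else 0

lemma pathLp_of_memLp {X : I → Ω → ℝ} {ω : Ω} (h : MemLp (path X ω) 2 (volume : Measure I)) :
    pathLp X ω = h.toLp _ := dif_pos h

lemma edist_pathLp_sq {X : I → Ω → ℝ} {ω : Ω} (h : MemLp (path X ω) 2 (volume : Measure I))
    {v : L2I} {f : I → ℝ} (hv : v =ᵐ[volume] f) :
    edist v (pathLp X ω) ^ 2 = ∫⁻ u : I, ‖f u - X u ω‖ₑ ^ 2 := by
  rw [pathLp_of_memLp h, Lp.edist_def,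
    eLpNorm_eq_lintegral_rpow_enorm_toReal (by simp) (by simp), ← ENNReal.rpow_natCast,
    ← ENNReal.rpow_mul]
  norm_num
  refine lintegral_congr_ae ?_
  filter_upwards [hv, h.coeFn_toLp] with u h1 h2
  simp [h1, h2, path]

variable [MeasurableSpace Ω] {P : Measure Ω}

lemma IsAdmissible.measurable_path {X : I → Ω → ℝ} (hX : IsAdmissible P X) :
    Measurable (path X) :=
  measurable_pi_lambda _ fun _ ↦ hX.measurable.comp (measurable_const.prodMk measurable_id)

lemma IsAdmissible.measurable_path_apply {X : I → Ω → ℝ} (hX : IsAdmissible P X) (ω : Ω) :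
    Measurable (path X ω) :=
  hX.measurable.comp (measurable_id.prodMk measurable_const)

lemma IsAdmissible.memLp {X : I → Ω → ℝ} (hX : IsAdmissible P X) :
    ∀ᵐ ω ∂P, MemLp (path X ω) 2 (volume : Measure I) := by
  filter_upwards [hX.bounded] with ω ⟨C, hC⟩
  exact MemLp.of_bound (hX.measurable_path_apply ω).aestronglyMeasurable C (ae_of_all _ hC)

omit [MeasurableSpace Ω] in
lemma norm_pathLp_sub {X Y : I → Ω → ℝ} {ω₁ ω₂ : Ω}
    (h₁ : MemLp (path X ω₁) 2 (volume : Measure I))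
    (h₂ : MemLp (path Y ω₂) 2 (volume : Measure I)) :
    ‖pathLp X ω₁ - pathLp Y ω₂‖ = l2norm (fun u ↦ X u ω₁ - Y u ω₂) := by
  have h := h₁.sub h₂
  rw [pathLp_of_memLp h₁, pathLp_of_memLp h₂, ← MemLp.toLp_sub, Lp.norm_toLp,
    h.eLpNorm_eq_integral_rpow_norm (by simp) (by simp), ENNReal.toReal_ofReal (by positivity),
    l2norm, Real.sqrt_eq_rpow]
  norm_num
  rfl

omit [MeasurableSpace Ω] in
lemma norm_pathLp {X : I → Ω → ℝ} {ω : Ω} (h : MemLp (path X ω) 2 (volume : Measure I)) :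
    ‖pathLp X ω‖ = l2norm (path X ω) := by
  rw [pathLp_of_memLp h, Lp.norm_toLp,
    h.eLpNorm_eq_integral_rpow_norm (by simp) (by simp), ENNReal.toReal_ofReal (by positivity),
    l2norm, Real.sqrt_eq_rpow]
  norm_num

/-- The mean square approximation in the definition of the stochastic integral is convergence in
probability in `L²[0,1]`. -/
lemma tendstoInMeasure_toL2_iff {X : I → Ω → ℝ} (hX : IsAdmissible P X)
    (S : ℕ → StepProcess (MeasurableSpace.comap (path X) inferInstance)) :
    (∀ ε : ℝ≥0∞, 0 < ε →
      Tendsto (fun n ↦ P {ω | ε ≤ ∫⁻ u : I, ‖(S n).eval u ω - X u ω‖ₑ ^ 2}) atTop (𝓝 0)) ↔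
    TendstoInMeasure P (fun n ↦ (S n).toL2) atTop (pathLp X) := by
  have key : ∀ (ε : ℝ≥0∞) n, P {ω | ε ^ 2 ≤ ∫⁻ u : I, ‖(S n).eval u ω - X u ω‖ₑ ^ 2} =
      P {ω | ε ≤ edist ((S n).toL2 ω) (pathLp X ω)} := by
    intro ε n
    refine measure_congr ?_
    filter_upwards [hX.memLp] with ω hω
    refine propext ?_
    change ε ^ 2 ≤ _ ↔ ε ≤ _
    rw [← edist_pathLp_sq hω ((S n).coeFn_toL2 ω)]
    exact ENNReal.pow_le_pow_left_iff (by simp)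
  constructor
  · intro h ε hε
    have := h (ε ^ 2) (by positivity)
    simpa only [key] using this
  · intro h ε hε
    have := h (ε ^ (1 / 2 : ℝ)) (ENNReal.rpow_pos_of_nonneg hε (by norm_num))
    simp only [← key] at this
    rw [← ENNReal.rpow_natCast, ← ENNReal.rpow_mul] at this
    simpa using this

/-- The `k`-th point of the grid of mesh `1 / (n + 1)` on the unit interval. -/
def gridPoint (n k : ℕ) : I := Set.projIcc 0 1 zero_le_one ((k : ℝ) / (n + 1))

lemma coe_gridPoint {n k : ℕ} (h : k ≤ n + 1) : (gridPoint n k : ℝ) = k / (n + 1) := by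
  have : (k : ℝ) ≤ n + 1 := by exact_mod_cast h
  rw [gridPoint, Set.coe_projIcc, min_eq_right (by rw [div_le_one (by positivity)]; exact this),
    max_eq_right (by positivity)]

lemma gridPoint_mono (n : ℕ) : Monotone (gridPoint n) := by
  intro k l h
  refine Set.monotone_projIcc _ ?_
  gcongr

/-- The step function with the values of `y` at the left end points of a grid, in `L²[0,1]`. -/
def gridL2 (n : ℕ) (y : I → ℝ) : L2I :=
  ∑ k : Fin (n + 1), y (gridPoint n k) • ind (gridPoint n k) (gridPoint n (k + 1))

lemma measurable_gridL2 (n : ℕ) : Measurable (gridL2 n) :=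
  Finset.measurable_fun_sum _ fun _ _ ↦ (measurable_pi_apply _).smul_const _

/-- The step process with the values of `X` at the left end points of a grid. -/
def gridProcess (X : I → Ω → ℝ) (n : ℕ) :
    StepProcess (MeasurableSpace.comap (path X) inferInstance) where
  size := n + 1
  left k := gridPoint n k
  right k := gridPoint n (k + 1)
  left_le_right k := gridPoint_mono n k.val.le_succ
  coeff k := X (gridPoint n k)
  measurable_coeff k := (measurable_pi_apply (gridPoint n k)).comp (comap_measurable (path X))

omit [MeasurableSpace Ω] in
lemma toL2_gridProcess (X : I → Ω → ℝ) (n : ℕ) (ω : Ω) :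
    (gridProcess X n).toL2 ω = gridL2 n (path X ω) := rfl

omit [MeasurableSpace Ω] in
lemma exists_eval_gridProcess (X : I → Ω → ℝ) (n : ℕ) {u : I} (hu : 0 < u) :
    ∃ v : I, |(v : ℝ) - u| ≤ 1 / (n + 1) ∧ ∀ ω, (gridProcess X n).eval u ω = X v ω := by
  have hn : (0 : ℝ) < n + 1 := by positivity
  have hu0 : (0 : ℝ) < u := hu
  have hu1 : (u : ℝ) ≤ 1 := u.2.2
  -- The cell `(k/(n+1), (k+1)/(n+1)]` containing `u` has `k + 1 = ⌈(n+1) u⌉`. Cells are open on the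
  -- left, so `0` lies in none of them.
  have hpos : 0 < ⌈(n + 1) * (u : ℝ)⌉₊ := Nat.ceil_pos.2 (by positivity)
  obtain ⟨k, hk⟩ : ∃ k, ⌈(n + 1) * (u : ℝ)⌉₊ = k + 1 := Nat.exists_eq_succ_of_ne_zero hpos.ne'
  have hkn : k < n + 1 := by
    have : ⌈(n + 1) * (u : ℝ)⌉₊ ≤ n + 1 := Nat.ceil_le.2 (by push_cast; nlinarith)
    omega
  have h1 : (k : ℝ) < (n + 1) * u := Nat.lt_ceil.1 (by omega)
  have h2 : (n + 1) * (u : ℝ) ≤ k + 1 := by exact_mod_cast Nat.ceil_le.1 hk.le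
  have e1 := coe_gridPoint hkn.le
  have e2 := coe_gridPoint (n := n) (k := k + 1) (by omega)
  have l1 : gridPoint n k < u := by
    rw [← Subtype.coe_lt_coe, e1, div_lt_iff₀ hn]; linarith
  have l2 : u ≤ gridPoint n (k + 1) := by
    rw [← Subtype.coe_le_coe, e2, le_div_iff₀ hn]; push_cast; linarith
  refine ⟨gridPoint n k, ?_, fun ω ↦ ?_⟩
  · rw [e1, abs_le]
    constructor
    · rw [neg_le_sub_iff_le_add, ← add_div, le_div_iff₀ hn]; linarith
    · have : (k : ℝ) / (n + 1) ≤ u := by rw [div_le_iff₀ hn]; linarith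
      have : 0 ≤ 1 / ((n : ℝ) + 1) := by positivity
      linarith
  · change ∑ j : Fin (n + 1), X (gridPoint n j) ω *
      (Set.Ioc (gridPoint n j) (gridPoint n (j + 1))).indicator 1 u = _
    rw [Finset.sum_eq_single (⟨k, hkn⟩ : Fin (n + 1))]
    · rw [Set.indicator_of_mem
        (show u ∈ Set.Ioc (gridPoint n k) (gridPoint n (k + 1)) from ⟨l1, l2⟩)]
      simp
    · intro j _ hj
      rw [Set.indicator_of_notMem, mul_zero]
      intro hmem
      obtain ⟨h3, h4⟩ := Set.mem_Ioc.1 hmem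
      apply hj
      ext
      change (j : ℕ) = k
      by_contra hne
      rcases Nat.lt_or_gt_of_ne hne with h | h
      · exact absurd (h4.trans (gridPoint_mono n (show (j : ℕ) + 1 ≤ k by omega))) (not_le.2 l1)
      · exact absurd (h3.trans_le (l2.trans (gridPoint_mono n (show k + 1 ≤ (j : ℕ) by omega))))
          (lt_irrefl _)
    · simp

lemma IsAdmissible.measurable_eval {X : I → Ω → ℝ} (hX : IsAdmissible P X) (n : ℕ) :
    Measurable fun z : Ω × I ↦ (gridProcess X n).eval z.2 z.1 := by
  refine Finset.measurable_fun_sum _ fun k _ ↦ Measurable.mul ?_ ?_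
  · exact ((measurable_pi_apply _).comp hX.measurable_path).comp measurable_fst
  · exact (measurable_one.indicator measurableSet_Ioc).comp measurable_snd

/-- The grid approximations converge to the process jointly in probability. -/
lemma IsAdmissible.tendstoInMeasure_eval [IsProbabilityMeasure P] {X : I → Ω → ℝ}
    (hX : IsAdmissible P X) :
    TendstoInMeasure (P.prod (volume : Measure I))
      (fun n (z : Ω × I) ↦ (gridProcess X n).eval z.2 z.1) atTop (fun z ↦ X z.2 z.1) := by
  intro ε hε
  have hmX : Measurable fun z : Ω × I ↦ X z.2 z.1 := hX.measurable.comp measurable_swap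
  have hm n : MeasurableSet {z : Ω × I | ε ≤ edist ((gridProcess X n).eval z.2 z.1) (X z.2 z.1)} :=
    measurableSet_le measurable_const ((hX.measurable_eval n).edist hmX)
  -- Slicing at fixed `u` turns the claim into stochastic continuity at `u`; the slices are
  -- probabilities, hence dominated by `1`.
  simp_rw [fun n ↦ Measure.prod_apply_symm (μ := P) (ν := (volume : Measure I)) (hm n)]
  rw [← lintegral_zero (μ := (volume : Measure I))]
  refine tendsto_lintegral_of_dominated_convergence (fun _ ↦ 1)
    (fun n ↦ measurable_measure_prodMk_right (hm n)) (fun n ↦ ae_of_all _ fun u ↦ prob_le_one)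
    (by simp) ?_
  have h0 : ∀ᵐ u : I, u ≠ 0 := by
    rw [ae_iff]
    simp
  filter_upwards [h0] with u hu
  choose v hv hv' using fun n ↦ exists_eval_gridProcess X n (unitInterval.pos_iff_ne_zero.2 hu)
  have hlim : Tendsto v atTop (𝓝 u) := by
    rw [tendsto_subtype_rng, tendsto_iff_dist_tendsto_zero]
    exact squeeze_zero (fun _ ↦ dist_nonneg) hv tendsto_one_div_add_atTop_nhds_zero_nat
  have := (hX.stochContinuous u ε hε).comp hlim
  simpa [hv', Function.comp_def] using this

/-- `pathLp` is defined by cases on square integrability, so its measurability is inherited from the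
measurable grid approximations. -/
lemma IsAdmissible.aemeasurable_pathLp_of_tendsto {X : I → Ω → ℝ} (hX : IsAdmissible P X)
    {ns : ℕ → ℕ} (h : ∀ᵐ ω ∂P, Tendsto (fun k ↦ gridL2 (ns k) (path X ω)) atTop
      (𝓝 (pathLp X ω))) : AEMeasurable (pathLp X) P :=
  aemeasurable_of_tendsto_metrizable_ae atTop
    (fun k ↦ ((measurable_gridL2 (ns k)).comp hX.measurable_path).aemeasurable) h

/-- The grid approximations converge to the process in probability in `L²[0,1]`. -/
lemma IsAdmissible.tendstoInMeasure_gridL2 [IsProbabilityMeasure P] {X : I → Ω → ℝ}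
    (hX : IsAdmissible P X) :
    TendstoInMeasure P (fun n ω ↦ gridL2 n (path X ω)) atTop (pathLp X) := by
  -- By the subsequence criterion it suffices to extract almost sure convergence. Joint convergence
  -- for almost every `(ω, u)`, together with boundedness of the path, gives `L²` convergence for
  -- almost every `ω` by dominated convergence.
  refine (exists_seq_tendstoInMeasure_atTop_iff
    fun n ↦ ((measurable_gridL2 n).comp hX.measurable_path).aestronglyMeasurable).2 ?_
  intro ns hns
  obtain ⟨ns', hns', h⟩ := (hX.tendstoInMeasure_eval.comp hns.tendsto_atTop).exists_seq_tendsto_ae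
  refine ⟨ns', hns', ?_⟩
  have h0 : ∀ᵐ u : I, u ≠ 0 := by
    rw [ae_iff]
    simp
  filter_upwards [Measure.ae_ae_of_ae_prod h, hX.bounded, hX.memLp] with ω h1 ⟨C, hC⟩ h2
  have key : Tendsto (fun k ↦ edist (gridL2 (ns (ns' k)) (path X ω)) (pathLp X ω) ^ 2) atTop
      (𝓝 0) := by
    simp_rw [← toL2_gridProcess, fun n ↦ edist_pathLp_sq h2 ((gridProcess X n).coeFn_toL2 ω)]
    rw [← lintegral_zero (μ := (volume : Measure I))]
    have hmeas (n) : Measurable fun u : I ↦ (gridProcess X n).eval u ω :=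
      (hX.measurable_eval n).comp (measurable_const.prodMk measurable_id)
    refine tendsto_lintegral_of_dominated_convergence (fun _ ↦ ENNReal.ofReal (C + C) ^ 2)
      (fun n ↦ ((hmeas _).sub (hX.measurable_path_apply ω)).enorm.pow_const 2)
      (fun n ↦ ?_) (by simp) ?_
    · filter_upwards [h0] with u hu
      obtain ⟨v, -, hv⟩ := exists_eval_gridProcess X (ns (ns' n)) (unitInterval.pos_iff_ne_zero.2 hu)
      rw [hv, ← ofReal_norm]
      gcongr
      exact (norm_sub_le _ _).trans (add_le_add (hC v) (hC u))
    · filter_upwards [h1] with u hu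
      have : Tendsto (fun k ↦ (gridProcess X (ns (ns' k))).eval u ω - X u ω) atTop (𝓝 0) := by
        simpa using hu.sub_const (X u ω)
      have := (this.enorm).ennrpow_const 2
      simpa using this
  rw [tendsto_iff_edist_tendsto_0]
  have e (x : ℝ≥0∞) : (x ^ 2) ^ (2⁻¹ : ℝ) = x := by
    rw [← ENNReal.rpow_natCast, ← ENNReal.rpow_mul]
    simp
  simpa [e] using! key.ennrpow_const (2⁻¹ : ℝ)

lemma IsAdmissible.aemeasurable_pathLp [IsProbabilityMeasure P] {X : I → Ω → ℝ}
    (hX : IsAdmissible P X) : AEMeasurable (pathLp X) P := by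
  obtain ⟨ns, -, h⟩ := hX.tendstoInMeasure_gridL2.exists_seq_tendsto_ae
  exact hX.aemeasurable_pathLp_of_tendsto h

/-- For two processes with the same law, the paths in `L²[0,1]` are the same measurable function
of the sample paths. -/
lemma exists_measurable_pathLp_eq [IsProbabilityMeasure P] {Y Y' : I → Ω → ℝ}
    (hY : IsAdmissible P Y) (hY' : IsAdmissible P Y')
    (h : P.map (path Y') = P.map (path Y)) :
    ∃ Φ : (I → ℝ) → L2I, Measurable Φ ∧ pathLp Y =ᵐ[P] Φ ∘ path Y ∧
      pathLp Y' =ᵐ[P] Φ ∘ path Y' := by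
  -- A subsequence good for both processes is needed, so that one limit functional of the path
  -- serves `Y` and `Y'`.
  obtain ⟨ns, hns, h1⟩ := hY.tendstoInMeasure_gridL2.exists_seq_tendsto_ae
  obtain ⟨ns', hns', h2⟩ :=
    (hY'.tendstoInMeasure_gridL2.comp hns.tendsto_atTop).exists_seq_tendsto_ae
  have h1' : ∀ᵐ ω ∂P, Tendsto (fun k ↦ gridL2 (ns (ns' k)) (path Y ω)) atTop (𝓝 (pathLp Y ω)) := by
    filter_upwards [h1] with ω hω using hω.comp hns'.tendsto_atTop
  have hlim : ∀ᵐ y ∂(P.map (path Y)), ∃ l, Tendsto (fun k ↦ gridL2 (ns (ns' k)) y) atTop (𝓝 l) := by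
    rw [ae_map_iff hY.measurable_path.aemeasurable
      (MeasureTheory.measurableSet_exists_tendsto fun k ↦ (measurable_gridL2 _))]
    filter_upwards [h1'] with ω hω using ⟨_, hω⟩
  obtain ⟨Φ, hΦ, hΦlim⟩ := measurable_limit_of_tendsto_metrizable_ae
    (fun k ↦ (measurable_gridL2 (ns (ns' k))).aemeasurable) hlim
  refine ⟨Φ, hΦ, ?_, ?_⟩
  · filter_upwards [h1', ae_of_ae_map hY.measurable_path.aemeasurable hΦlim] with ω a b
    exact tendsto_nhds_unique a b
  · rw [← h] at hΦlim
    filter_upwards [h2, ae_of_ae_map hY'.measurable_path.aemeasurable hΦlim] with ω a b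
    exact tendsto_nhds_unique a b

end

/-! ### Wiener integrals of deterministic functions -/

section

variable {Ω : Type*}

/-- The increment of `B` over the interval `(a, b]`. -/
def increment (B : I → Ω → ℝ) (p : {p : I × I // p.1 ≤ p.2}) (ω : Ω) : ℝ :=
  B p.1.2 ω - B p.1.1 ω

/-- The pairs consisting of a step function and of its elementary integral. -/
def elementaryPairs (B : I → Ω → ℝ) : Submodule ℝ (L2I × (Ω → ℝ)) :=
  Submodule.span ℝ (Set.range fun p : {p : I × I // p.1 ≤ p.2} ↦
    (ind p.1.1 p.1.2, increment B p))

/-- Working in a span of pairs gives linearity without having to know that the elementary integral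
depends only on the step function. -/
lemma exists_finsupp_of_mem_elementaryPairs {B : I → Ω → ℝ} {h : L2I} {J : Ω → ℝ}
    (hJ : (h, J) ∈ elementaryPairs B) :
    ∃ c : {p : I × I // p.1 ≤ p.2} →₀ ℝ, h = ∑ p ∈ c.support, c p • ind p.1.1 p.1.2 ∧
      J = fun ω ↦ ∑ p ∈ c.support, c p • increment B p ω := by
  obtain ⟨c, hc⟩ := Finsupp.mem_span_range_iff_exists_finsupp.1 hJ
  refine ⟨c, ?_, ?_⟩
  · simpa [Finsupp.sum, Prod.fst_sum] using (congrArg Prod.fst hc).symm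
  · ext ω
    simpa [Finsupp.sum, Prod.snd_sum] using (congrFun (congrArg Prod.snd hc) ω).symm

/-- The right-hand side is what bilinearity makes of the covariance `min u v` for increments over
the two intervals. -/
lemma real_inner_ind {a b c d : I} (hab : a ≤ b) (hcd : c ≤ d) :
    inner ℝ (ind a b) (ind c d) =
      min (b : ℝ) d - min (b : ℝ) c - min (a : ℝ) d + min (a : ℝ) c := by
  have hab' : (a : ℝ) ≤ b := hab
  have hcd' : (c : ℝ) ≤ d := hcd
  rw [ind, ind, L2.real_inner_indicatorConstLp_one_indicatorConstLp_one, Set.Ioc_inter_Ioc,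
    measureReal_def, unitInterval.volume_Ioc, ENNReal.toReal_ofReal']
  have e1 : ((a ⊔ c : I) : ℝ) = max (a : ℝ) c := (Subtype.mono_coe _).map_max
  have e2 : ((b ⊓ d : I) : ℝ) = min (b : ℝ) d := (Subtype.mono_coe _).map_min
  rw [e1, e2]
  rcases le_total (a : ℝ) c with h1 | h1 <;> rcases le_total (b : ℝ) d with h2 | h2 <;>
    rcases le_total (b : ℝ) c with h3 | h3 <;> rcases le_total (a : ℝ) d with h4 | h4 <;>
    simp only [h1, h2, h3, h4, max_eq_left, max_eq_right, min_eq_left, min_eq_right] <;>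
    first
      | (rw [max_eq_left (by linarith)]; linarith)
      | (rw [max_eq_right (by linarith)]; linarith)

variable [MeasurableSpace Ω] {P : Measure Ω}

lemma IsBrownianUnit.memLp_increment {B : I → Ω → ℝ} (hB : IsBrownianUnit P B)
    (p : {p : I × I // p.1 ≤ p.2}) : MemLp (increment B p) 2 P :=
  (hB.gaussian.hasGaussianLaw_eval _).memLp_two.sub (hB.gaussian.hasGaussianLaw_eval _).memLp_two

/-- The Itô isometry on generators; bilinearity extends it in `variance_eq`. -/
lemma IsBrownianUnit.cov_increment [IsProbabilityMeasure P] {B : I → Ω → ℝ}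
    (hB : IsBrownianUnit P B) (p q : {p : I × I // p.1 ≤ p.2}) :
    cov[increment B p, increment B q; P] = inner ℝ (ind p.1.1 p.1.2) (ind q.1.1 q.1.2) := by
  have hm u : MemLp (B u) 2 P := (hB.gaussian.hasGaussianLaw_eval u).memLp_two
  rw [real_inner_ind p.2 q.2, show increment B p = fun ω ↦ B p.1.2 ω - B p.1.1 ω from rfl,
    show increment B q = fun ω ↦ B q.1.2 ω - B q.1.1 ω from rfl,
    covariance_fun_sub_fun_sub (hm _) (hm _) (hm _) (hm _)]
  simp only [hB.cov]

section elementary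

variable {B : I → Ω → ℝ} {h : L2I} {J : Ω → ℝ}

lemma IsBrownianUnit.hasGaussianLaw (hB : IsBrownianUnit P B)
    (hJ : (h, J) ∈ elementaryPairs B) : HasGaussianLaw J P := by
  classical
  obtain ⟨c, -, rfl⟩ := exists_finsupp_of_mem_elementaryPairs hJ
  have : IsGaussianProcess (increment B) P := by
    refine hB.gaussian.of_isGaussianProcess fun p ↦ ⟨{p.1.1, p.1.2},
      ContinuousLinearMap.proj ⟨p.1.2, by simp⟩ - ContinuousLinearMap.proj ⟨p.1.1, by simp⟩, ?_⟩
    intro ω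
    simp [increment]
  exact (this.smul c).hasGaussianLaw_fun_sum

lemma IsBrownianUnit.integral_eq_zero [IsProbabilityMeasure P] (hB : IsBrownianUnit P B)
    (hJ : (h, J) ∈ elementaryPairs B) : ∫ ω, J ω ∂P = 0 := by
  obtain ⟨c, -, rfl⟩ := exists_finsupp_of_mem_elementaryPairs hJ
  have hi u : Integrable (B u) P :=
    (hB.gaussian.hasGaussianLaw_eval u).memLp_two.integrable (by norm_num)
  have hint (p) : Integrable (fun ω ↦ c p • increment B p ω) P :=
    ((hB.memLp_increment p).integrable (by norm_num)).smul (c p)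
  beta_reduce
  rw [integral_finsetSum _ fun p _ ↦ hint p]
  refine Finset.sum_eq_zero fun p _ ↦ ?_
  rw [integral_smul]
  simp [increment, integral_sub (hi _) (hi _), hB.mean]

lemma IsBrownianUnit.variance_eq [IsProbabilityMeasure P] (hB : IsBrownianUnit P B)
    (hJ : (h, J) ∈ elementaryPairs B) : Var[J; P] = ‖h‖ ^ 2 := by
  have hG := hB.hasGaussianLaw hJ
  obtain ⟨c, rfl, rfl⟩ := exists_finsupp_of_mem_elementaryPairs hJ
  have hm (p) : MemLp (fun ω ↦ c p • increment B p ω) 2 P := (hB.memLp_increment p).const_smul (c p)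
  rw [← covariance_self hG.aemeasurable, covariance_fun_sum_fun_sum' (fun p _ ↦ hm p)
    (fun p _ ↦ hm p), ← real_inner_self_eq_norm_sq, sum_inner]
  simp_rw [inner_sum, smul_eq_mul, covariance_const_mul_left, covariance_const_mul_right,
    hB.cov_increment, real_inner_smul_left, real_inner_smul_right]

lemma IsBrownianUnit.integral_expi [IsProbabilityMeasure P] (hB : IsBrownianUnit P B)
    (hJ : (h, J) ∈ elementaryPairs B) (s : ℝ) :
    ∫ ω, expi s J ω ∂P = Complex.exp (-(s ^ 2 * ‖h‖ ^ 2 / 2)) := by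
  have hG := hB.hasGaussianLaw hJ
  have h1 := charFun_gaussianReal (μ := 0) (v := (‖h‖ ^ 2).toNNReal) s
  have h2 := hG.map_eq_gaussianReal
  rw [hB.integral_eq_zero hJ, hB.variance_eq hJ] at h2
  rw [← h2, charFun_apply_real, integral_map hG.aemeasurable (by fun_prop)] at h1
  simp only [expi]
  calc _ = ∫ ω, Complex.exp (s * J ω * Complex.I) ∂P := by
        refine integral_congr_ae (ae_of_all _ fun ω ↦ ?_)
        ring_nf
    _ = _ := by
        rw [h1, Real.coe_toNNReal _ (by positivity)]
        congr 1
        push_cast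
        ring

/-- The `L¹` norm is at most the `L²` norm on a probability space, and the latter is given by the
isometry. -/
lemma IsBrownianUnit.lintegral_enorm_le [IsProbabilityMeasure P] (hB : IsBrownianUnit P B)
    (hJ : (h, J) ∈ elementaryPairs B) : ∫⁻ ω, ‖J ω‖ₑ ∂P ≤ ‖h‖ₑ := by
  have hG := hB.hasGaussianLaw hJ
  have hm : MemLp J 2 P := hG.memLp_two
  have h0 : ∫ ω, J ω ^ 2 ∂P = ‖h‖ ^ 2 := by
    rw [← hB.variance_eq hJ, variance_of_integral_eq_zero hG.aemeasurable (hB.integral_eq_zero hJ)]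
  have h1 : eLpNorm J 2 P = ‖h‖ₑ := by
    rw [hm.eLpNorm_eq_integral_rpow_norm (by simp) (by simp)]
    have : ∫ ω, ‖J ω‖ ^ (2 : ℝ) ∂P = ‖h‖ ^ 2 := by simpa using h0
    rw [ENNReal.toReal_ofNat, this, ← one_div, ← Real.sqrt_eq_rpow, ← ofReal_norm,
      Real.sqrt_sq (norm_nonneg _)]
  rw [← h1, ← eLpNorm_one_eq_lintegral_enorm]
  exact eLpNorm_le_eLpNorm_of_exponent_le (by norm_num) hm.1

end elementary

/-- `f` is a version of the Wiener integral `∫₀¹ h dB`. -/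
def IsWienerIntegral (P : Measure Ω) (B : I → Ω → ℝ) (h : L2I) (f : Ω → ℝ) : Prop :=
  ∃ (v : ℕ → L2I) (J : ℕ → Ω → ℝ), (∀ n, (v n, J n) ∈ elementaryPairs B) ∧
    Tendsto v atTop (𝓝 h) ∧ ∀ᵐ ω ∂P, Tendsto (fun n ↦ J n ω) atTop (𝓝 (f ω))

lemma IsWienerIntegral.sub {B : I → Ω → ℝ} {h h' : L2I} {f f' : Ω → ℝ}
    (H : IsWienerIntegral P B h f) (H' : IsWienerIntegral P B h' f') :
    IsWienerIntegral P B (h - h') (fun ω ↦ f ω - f' ω) := by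
  obtain ⟨v, J, h1, h2, h3⟩ := H
  obtain ⟨v', J', h1', h2', h3'⟩ := H'
  refine ⟨fun n ↦ v n - v' n, fun n ↦ J n - J' n, fun n ↦ ?_, h2.sub h2', ?_⟩
  · exact Submodule.sub_mem _ (h1 n) (h1' n)
  · filter_upwards [h3, h3'] with ω a b using a.sub b

omit [MeasurableSpace Ω] in
lemma norm_expi (s : ℝ) (Z : Ω → ℝ) (ω : Ω) : ‖expi s Z ω‖ = 1 := by
  rw [expi, show Complex.I * s * Z ω = ((s * Z ω : ℝ) : ℂ) * Complex.I by push_cast; ring]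
  exact Complex.norm_exp_ofReal_mul_I _

/-- Almost sure convergence suffices to pass to the limit in the Gaussian characteristic functions,
because the integrands have modulus one. -/
lemma IsWienerIntegral.integral_expi [IsProbabilityMeasure P] {B : I → Ω → ℝ}
    (hB : IsBrownianUnit P B) {h : L2I} {f : Ω → ℝ} (H : IsWienerIntegral P B h f) (s : ℝ) :
    ∫ ω, expi s f ω ∂P = (Real.exp (-(s ^ 2 * ‖h‖ ^ 2 / 2)) : ℝ) := by
  obtain ⟨v, J, h1, h2, h3⟩ := H
  have e1 : Tendsto (fun n ↦ ∫ ω, expi s (J n) ω ∂P) atTop (𝓝 (∫ ω, expi s f ω ∂P)) := by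
    refine tendsto_integral_of_dominated_convergence (fun _ ↦ 1) (fun n ↦ ?_)
      (integrable_const _) (fun n ↦ ae_of_all _ fun ω ↦ (norm_expi _ _ _).le) ?_
    · have := (hB.hasGaussianLaw (h1 n)).aemeasurable.aestronglyMeasurable
      exact (Complex.continuous_exp.comp (continuous_const.mul
        Complex.continuous_ofReal)).comp_aestronglyMeasurable this
    · filter_upwards [h3] with ω hω
      exact ((Complex.continuous_exp.comp (continuous_const.mul
        Complex.continuous_ofReal)).tendsto _).comp hω
  have e2 : Tendsto (fun n ↦ ∫ ω, expi s (J n) ω ∂P) atTop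
      (𝓝 ((Real.exp (-(s ^ 2 * ‖h‖ ^ 2 / 2)) : ℝ) : ℂ)) := by
    simp_rw [fun n ↦ hB.integral_expi (h1 n) s]
    have : Continuous fun w : L2I ↦ Complex.exp (-((s : ℂ) ^ 2 * (‖w‖ : ℂ) ^ 2 / 2)) := by fun_prop
    simpa [Function.comp_def] using (this.tendsto h).comp h2
  exact tendsto_nhds_unique e1 e2

end

/-! ### The stochastic integral: measurable functional of the paths, and existence -/

section

variable {Ω : Type*} [MeasurableSpace Ω] {P : Measure Ω} {X B : I → Ω → ℝ}

omit [MeasurableSpace Ω] in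
-- Coefficients measurable for `σ(X)` factor through the path of `X`. Freezing that path therefore
-- leaves the elementary integral of a deterministic step function.
lemma StepProcess.exists_integral_eq
    (S : StepProcess (MeasurableSpace.comap (path X) inferInstance)) (B : I → Ω → ℝ) :
    ∃ J : (I → ℝ) × (I → ℝ) → ℝ, Measurable J ∧
      (∀ ω, S.integral B ω = J (path X ω, path B ω)) ∧
      ∀ ω', (S.toL2 ω', fun ω ↦ J (path X ω', path B ω)) ∈ elementaryPairs B := by
  choose g hg hgc using fun i ↦ (S.measurable_coeff i).exists_eq_measurable_comp
  refine ⟨fun z ↦ ∑ i, g i z.1 * (z.2 (S.right i) - z.2 (S.left i)), ?_, fun ω ↦ ?_, fun ω' ↦ ?_⟩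
  · refine Finset.measurable_fun_sum _ fun i _ ↦ ((hg i).comp measurable_fst).mul ?_
    exact ((measurable_pi_apply _).comp measurable_snd).sub
      ((measurable_pi_apply _).comp measurable_snd)
  · simp only [StepProcess.integral, hgc]
    rfl
  · have : (S.toL2 ω', fun ω ↦ ∑ i, g i (path X ω') *
          (path B ω (S.right i) - path B ω (S.left i))) =
        ∑ i, S.coeff i ω' • (ind (S.left i) (S.right i),
          increment B ⟨(S.left i, S.right i), S.left_le_right i⟩) := by
      ext1
      · simp [Prod.fst_sum, StepProcess.toL2]
      · ext ω
        simp [Prod.snd_sum, hgc, increment, path]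
    rw [this]
    exact Submodule.sum_mem _ fun i _ ↦ Submodule.smul_mem _ _ 
      (Submodule.subset_span ⟨⟨(S.left i, S.right i), S.left_le_right i⟩, rfl⟩)

lemma IsBrownianUnit.measurable_path (hB : IsBrownianUnit P B) : Measurable (path B) :=
  measurable_pi_lambda _ hB.measurable

/-- Independence makes the joint law a product, so an almost sure property survives freezing one
variable. -/
lemma ae_ae_of_indepFun {E F : Type*} [MeasurableSpace E] [MeasurableSpace F]
    [IsProbabilityMeasure P] {U : Ω → E} {V : Ω → F} (hU : Measurable U) (hV : Measurable V)
    (h : IndepFun U V P) {p : E × F → Prop} (hp : ∀ᵐ z ∂(P.map fun ω ↦ (U ω, V ω)), p z) :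
    ∀ᵐ ω' ∂P, ∀ᵐ ω ∂P, p (U ω', V ω) := by
  rw [(indepFun_iff_map_prod_eq_prod_map_map hU.aemeasurable hV.aemeasurable).1 h] at hp
  have : IsProbabilityMeasure (P.map V) := Measure.isProbabilityMeasure_map hV.aemeasurable
  filter_upwards [ae_of_ae_map hU.aemeasurable (Measure.ae_ae_of_ae_prod hp)] with ω' hω'
  exact ae_of_ae_map hV.aemeasurable hω'

/-- A stochastic integral is a measurable function of the integrand and the Brownian motion, and
for a fixed integrand it is the Wiener integral. -/
lemma IsStochIntegral.exists_measurable [IsProbabilityMeasure P] (hX : IsAdmissible P X)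
    (hB : IsBrownianUnit P B) (hXB : IndepFun (path X) (path B) P) {Z : Ω → ℝ}
    (hZ : IsStochIntegral P X B Z) :
    ∃ J : (I → ℝ) × (I → ℝ) → ℝ, Measurable J ∧ (∀ᵐ ω ∂P, Z ω = J (path X ω, path B ω)) ∧
      ∀ᵐ ω' ∂P, IsWienerIntegral P B (pathLp X ω') (fun ω ↦ J (path X ω', path B ω)) := by
  obtain ⟨-, S, hS, hSB⟩ := hZ
  rw [tendstoInMeasure_toL2_iff hX] at hS
  obtain ⟨ns, hns, h1⟩ := hS.exists_seq_tendsto_ae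
  obtain ⟨ns', hns', h2⟩ := (hSB.comp hns.tendsto_atTop).exists_seq_tendsto_ae
  choose J hJ hJint hJmem using fun n ↦ (S n).exists_integral_eq B
  have hpair : Measurable fun ω ↦ (path X ω, path B ω) :=
    hX.measurable_path.prodMk hB.measurable_path
  have h3 : ∀ᵐ z ∂(P.map fun ω ↦ (path X ω, path B ω)), ∃ l,
      Tendsto (fun k ↦ J (ns (ns' k)) z) atTop (𝓝 l) := by
    rw [ae_map_iff hpair.aemeasurable (MeasureTheory.measurableSet_exists_tendsto fun k ↦ hJ _)]
    filter_upwards [h2] with ω hω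
    exact ⟨_, by simpa [hJint] using hω⟩
  obtain ⟨K, hK, hKlim⟩ := measurable_limit_of_tendsto_metrizable_ae
    (fun k ↦ (hJ (ns (ns' k))).aemeasurable) h3
  refine ⟨K, hK, ?_, ?_⟩
  · filter_upwards [h2, ae_of_ae_map hpair.aemeasurable hKlim] with ω a b
    exact tendsto_nhds_unique (by simpa [hJint] using a) b
  -- For almost every frozen path both the step functions and their elementary integrals converge,
  -- which is what a Wiener integral requires.
  · filter_upwards [ae_ae_of_indepFun hX.measurable_path hB.measurable_path hXB hKlim, h1]
      with ω' a b
    exact ⟨_, _, fun k ↦ hJmem (ns (ns' k)) ω', b.comp hns'.tendsto_atTop, a⟩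

/-- Summable terms are eventually below `1`, where the truncation is inactive, so the tail is
Cauchy. -/
lemma exists_tendsto_of_tsum_min_edist_ne_top {u : ℕ → ℝ}
    (h : ∑' k, min 1 (edist (u k) (u (k + 1))) ≠ ∞) : ∃ l, Tendsto u atTop (𝓝 l) := by
  have h1 := ENNReal.tendsto_atTop_zero_of_tsum_ne_top h
  obtain ⟨N, hN⟩ := eventually_atTop.1 (h1.eventually_lt_const one_pos)
  have h2 : CauchySeq fun k ↦ u (k + N) := by
    refine cauchySeq_of_edist_le_of_tsum_ne_top
      (fun k ↦ min 1 (edist (u (k + N)) (u (k + N + 1)))) (fun k ↦ ?_) ?_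
    · have := hN (k + N) (by omega)
      have h3 : edist (u (k + N)) (u (k + N + 1)) ≤ 1 := by
        by_contra hcon
        rw [min_eq_left (not_le.1 hcon).le] at this
        exact lt_irrefl _ this
      rw [min_eq_right h3, Nat.succ_eq_add_one, add_right_comm]
    · exact ne_top_of_le_ne_top h
        (ENNReal.tsum_comp_le_tsum_of_injective (add_left_injective N) _)
  obtain ⟨l, hl⟩ := cauchySeq_tendsto_of_complete h2
  exact ⟨l, (tendsto_add_atTop_iff_nat N).1 hl⟩

lemma min_one_add_le (a b : ℝ≥0∞) : min 1 (a + b) ≤ min 1 a + min 1 b := by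
  rcases le_total 1 a with h | h
  · rw [min_eq_left h]
    exact (min_le_left _ _).trans le_self_add
  rcases le_total 1 b with h' | h'
  · rw [min_eq_left h']
    exact (min_le_left _ _).trans le_add_self
  · rw [min_eq_right h, min_eq_right h']
    exact min_le_right _ _

/-- After freezing the path of `X`, this is the `L¹` bound for a Wiener integral. Truncation at `1`
removes any need for moments of `X`. -/
lemma IsBrownianUnit.lintegral_min_edist_le [IsProbabilityMeasure P] (hX : IsAdmissible P X)
    (hB : IsBrownianUnit P B) (hXB : IndepFun (path X) (path B) P)
    (S T : StepProcess (MeasurableSpace.comap (path X) inferInstance)) :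
    ∫⁻ ω, min 1 (edist (S.integral B ω) (T.integral B ω)) ∂P ≤
      ∫⁻ ω, min 1 (edist (S.toL2 ω) (T.toL2 ω)) ∂P := by
  obtain ⟨J, hJ, hJint, hJmem⟩ := S.exists_integral_eq B
  obtain ⟨K, hK, hKint, hKmem⟩ := T.exists_integral_eq B
  have hm : Measurable fun z ↦ min 1 (edist (J z) (K z)) :=
    measurable_const.min (hJ.edist hK)
  have : IsProbabilityMeasure (P.map (path B)) :=
    Measure.isProbabilityMeasure_map hB.measurable_path.aemeasurable
  have h1 : ∫⁻ ω, min 1 (edist (S.integral B ω) (T.integral B ω)) ∂P =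
      ∫⁻ ω', ∫⁻ ω, min 1 (edist (J (path X ω', path B ω)) (K (path X ω', path B ω))) ∂P ∂P := by
    simp_rw [hJint, hKint]
    rw [← lintegral_map (g := fun ω ↦ (path X ω, path B ω)) hm
      (hX.measurable_path.prodMk hB.measurable_path),
      (indepFun_iff_map_prod_eq_prod_map_map hX.measurable_path.aemeasurable
        hB.measurable_path.aemeasurable).1 hXB, lintegral_prod _ hm.aemeasurable,
      lintegral_map hm.lintegral_prod_right' hX.measurable_path]
    refine lintegral_congr fun ω' ↦ ?_
    exact lintegral_map (hm.comp measurable_prodMk_left) hB.measurable_path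
  rw [h1]
  refine lintegral_mono fun ω' ↦ le_min ?_ ?_
  · exact (lintegral_mono fun _ ↦ min_le_left _ _).trans (by simp)
  · refine (lintegral_mono fun _ ↦ min_le_right _ _).trans ?_
    simp_rw [edist_eq_enorm_sub]
    exact hB.lintegral_enorm_le (Submodule.sub_mem _ (hJmem ω') (hKmem ω'))

/-- Existence of the stochastic integral of a process that is independent of `B`. -/
theorem exists_isStochIntegral [IsProbabilityMeasure P] (hX : IsAdmissible P X)
    (hB : IsBrownianUnit P B) (hXB : IndepFun (path X) (path B) P) :
    ∃ Z, IsStochIntegral P X B Z := by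
  obtain ⟨ns, hns, h1⟩ := hX.tendstoInMeasure_gridL2.exists_seq_tendsto_ae
  have hm n : Measurable fun ω ↦ gridL2 n (path X ω) :=
    (measurable_gridL2 n).comp hX.measurable_path
  have h2 : Tendsto (fun k ↦ ∫⁻ ω, min 1 (edist (gridL2 (ns k) (path X ω)) (pathLp X ω)) ∂P)
      atTop (𝓝 0) := by
    rw [← lintegral_zero (μ := P)]
    refine tendsto_lintegral_of_dominated_convergence' (fun _ ↦ 1)
      (fun k ↦ aemeasurable_const.min ((hm _).aemeasurable.edist hX.aemeasurable_pathLp))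
      (fun k ↦ ae_of_all _ fun ω ↦ min_le_left _ _) (by simp) ?_
    filter_upwards [h1] with ω hω
    have := (tendsto_iff_edist_tendsto_0.1 hω)
    simpa using tendsto_const_nhds (x := (1 : ℝ≥0∞)).min this
  -- Errors below `2⁻ⁿ` make the truncated distances between successive elementary integrals
  -- summable in mean, hence almost surely.
  obtain ⟨φ, hφ, h3⟩ := extraction_forall_of_eventually'
    (P := fun n k ↦ ∫⁻ ω, min 1 (edist (gridL2 (ns k) (path X ω)) (pathLp X ω)) ∂P < 2⁻¹ ^ n)
    fun n ↦ ((h2.eventually_lt_const (u := (2⁻¹ : ℝ≥0∞) ^ n) (ENNReal.pow_pos (by simp) n)).exists_forall_of_atTop)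
  set S := fun k ↦ gridProcess X (ns (φ k)) with hS
  have hI k : Measurable ((S k).integral B) := by
    obtain ⟨J, hJ, hJint, -⟩ := (S k).exists_integral_eq B
    rw [funext hJint]
    exact hJ.comp (hX.measurable_path.prodMk hB.measurable_path)
  have h4 k : ∫⁻ ω, min 1 (edist ((S k).integral B ω) ((S (k + 1)).integral B ω)) ∂P ≤
      2⁻¹ ^ k + 2⁻¹ ^ (k + 1) := by
    refine (hB.lintegral_min_edist_le hX hXB _ _).trans ?_
    refine le_trans ?_ (add_le_add (h3 k).le (h3 (k + 1)).le)
    rw [← lintegral_add_left' (aemeasurable_const.min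
      ((hm _).aemeasurable.edist hX.aemeasurable_pathLp))]
    refine lintegral_mono fun ω ↦ le_trans ?_ (min_one_add_le _ _)
    refine min_le_min_left _ ?_
    rw [edist_comm (gridL2 (ns (φ (k + 1))) _)]
    exact edist_triangle _ _ _
  have h5 : ∀ᵐ ω ∂P, ∃ l, Tendsto (fun k ↦ (S k).integral B ω) atTop (𝓝 l) := by
    have hmeas k : Measurable fun ω ↦
        min 1 (edist ((S k).integral B ω) ((S (k + 1)).integral B ω)) :=
      measurable_const.min ((hI _).edist (hI _))
    have : ∫⁻ ω, ∑' k, min 1 (edist ((S k).integral B ω) ((S (k + 1)).integral B ω)) ∂P ≠ ∞ := by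
      rw [lintegral_tsum fun k ↦ (hmeas k).aemeasurable]
      refine ne_top_of_le_ne_top ?_ (ENNReal.tsum_le_tsum h4)
      rw [ENNReal.tsum_add]
      simp_rw [pow_succ]
      rw [ENNReal.tsum_mul_right, ENNReal.tsum_geometric]
      simp [ENNReal.mul_eq_top]
    filter_upwards [ae_lt_top (Measurable.tsum hmeas) this] with ω hω
    exact exists_tendsto_of_tsum_min_edist_ne_top hω.ne
  obtain ⟨Z, hZ, hZlim⟩ := measurable_limit_of_tendsto_metrizable_ae
    (fun k ↦ (hI k).aemeasurable) h5
  refine ⟨Z, hZ.aemeasurable, S, ?_,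
    tendstoInMeasure_of_tendsto_ae (fun k ↦ (hI k).aestronglyMeasurable) hZlim⟩
  rw [tendstoInMeasure_toL2_iff hX]
  exact hX.tendstoInMeasure_gridL2.comp (hns.comp hφ).tendsto_atTop

lemma isStochIntegral_stochIntegral [IsProbabilityMeasure P] (hX : IsAdmissible P X)
    (hB : IsBrownianUnit P B) (hXB : IndepFun (path X) (path B) P) :
    IsStochIntegral P X B (stochIntegral P X B) := by
  have h := exists_isStochIntegral hX hB hXB
  rw [stochIntegral, dif_pos h]
  exact h.choose_spec

end

/-! ### The conditional second moment through two independent copies -/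

section

variable {Ω : Type*} [MeasurableSpace Ω] {P : Measure Ω} [IsProbabilityMeasure P]

section indep

variable {E F G : Type*} [MeasurableSpace E] [MeasurableSpace F] [MeasurableSpace G]

/-- Reassociating product laws. It yields independence of the triple `(Y', X, Y)` from `(B₁, B₂)`.
-/
lemma indepFun_prodMk_of_indepFun {W : Ω → E} {U : Ω → F} {V : Ω → G}
    (hW : Measurable W) (hU : Measurable U) (hV : Measurable V)
    (h : IndepFun W (fun ω ↦ (U ω, V ω)) P) (hUV : IndepFun U V P) :
    IndepFun (fun ω ↦ (W ω, U ω)) V P := by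
  have hWU : IndepFun W U P := h.comp measurable_id measurable_fst
  rw [indepFun_iff_map_prod_eq_prod_map_map hW.aemeasurable (hU.prodMk hV).aemeasurable] at h
  rw [indepFun_iff_map_prod_eq_prod_map_map hU.aemeasurable hV.aemeasurable] at hUV
  rw [indepFun_iff_map_prod_eq_prod_map_map hW.aemeasurable hU.aemeasurable] at hWU
  rw [indepFun_iff_map_prod_eq_prod_map_map (hW.prodMk hU).aemeasurable hV.aemeasurable, hWU]
  have hpW := Measure.isProbabilityMeasure_map (μ := P) hW.aemeasurable
  have hpU := Measure.isProbabilityMeasure_map (μ := P) hU.aemeasurable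
  have hpV := Measure.isProbabilityMeasure_map (μ := P) hV.aemeasurable
  have e : (fun ω ↦ ((W ω, U ω), V ω)) =
      MeasurableEquiv.prodAssoc.symm ∘ fun ω ↦ (W ω, (U ω, V ω)) := rfl
  rw [e, ← Measure.map_map MeasurableEquiv.prodAssoc.symm.measurable (hW.prodMk (hU.prodMk hV)),
    h, hUV, ← Measure.prodAssoc_prod, MeasurableEquiv.map_symm_map]

/-- Conditioning a function of two independent random variables on one of them. -/
lemma condExp_ae_eq_integral_of_indepFun {U : Ω → E} {V : Ω → F} (hU : Measurable U)
    (hV : Measurable V) (hUV : IndepFun U V P) {f : E × F → ℂ} (hf : Measurable f) {C : ℝ}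
    (hC : ∀ z, ‖f z‖ ≤ C) :
    (fun ω ↦ ∫ ω', f (U ω', V ω) ∂P) =ᵐ[P]
      P[fun ω ↦ f (U ω, V ω) | MeasurableSpace.comap V inferInstance] := by
  have hpU := Measure.isProbabilityMeasure_map (μ := P) hU.aemeasurable
  have hpV := Measure.isProbabilityMeasure_map (μ := P) hV.aemeasurable
  set h : F → ℂ := fun v ↦ ∫ u, f (u, v) ∂(P.map U) with hh
  have hhm : StronglyMeasurable h := hf.stronglyMeasurable.integral_prod_left'
  have hhe : (fun ω ↦ ∫ ω', f (U ω', V ω) ∂P) = h ∘ V := by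
    ext ω
    exact (integral_map hU.aemeasurable
      (hf.comp measurable_prodMk_right).aestronglyMeasurable).symm
  have hhC v : ‖h v‖ ≤ C := by
    refine (norm_integral_le_of_norm_le_const (ae_of_all _ fun u ↦ hC (u, v))).trans ?_
    simp
  rw [hhe]
  refine ae_eq_condExp_of_forall_setIntegral_eq hV.comap_le
    (.of_bound (hf.comp (hU.prodMk hV)).aestronglyMeasurable C (ae_of_all _ fun _ ↦ hC _))
    (fun s _ _ ↦ (Integrable.of_bound (hhm.comp_measurable hV).aestronglyMeasurable C
      (ae_of_all _ fun _ ↦ hhC _)).integrableOn) ?_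
    (hhm.comp_measurable (comap_measurable V)).aestronglyMeasurable
  rintro _ ⟨t, ht, rfl⟩ -
  have e1 : ∫ ω in V ⁻¹' t, f (U ω, V ω) ∂P =
      ∫ z in Set.univ ×ˢ t, f z ∂(P.map fun ω ↦ (U ω, V ω)) := by
    rw [setIntegral_map (MeasurableSet.univ.prod ht) hf.aestronglyMeasurable
      (hU.prodMk hV).aemeasurable]
    congr 2
    ext; simp
  have e2 : ∫ ω in V ⁻¹' t, (h ∘ V) ω ∂P = ∫ v in t, h v ∂(P.map V) := by
    rw [setIntegral_map ht hhm.aestronglyMeasurable hV.aemeasurable]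
    rfl
  rw [e1, e2, (indepFun_iff_map_prod_eq_prod_map_map hU.aemeasurable hV.aemeasurable).1 hUV,
    ← Measure.prod_restrict, Measure.restrict_univ, integral_prod_symm]
  exact .of_bound hf.aestronglyMeasurable C (ae_of_all _ hC)

/-- The second moment of a conditional expectation in terms of two independent copies. -/
lemma integral_norm_condExp_sq {U : Ω → E} {V : Ω → F} (hU : Measurable U)
    (hV : Measurable V) (hUV : IndepFun U V P) {f : E × F → ℂ} (hf : Measurable f) {C : ℝ}
    (hC : ∀ z, ‖f z‖ ≤ C) {W : Ω → ℂ} (hW : W =ᵐ[P] fun ω ↦ f (U ω, V ω)) :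
    ((∫ ω, ‖(P[W | MeasurableSpace.comap V inferInstance]) ω‖ ^ 2 ∂P : ℝ) : ℂ) =
      ∫ z : Ω × Ω, ∫ ω, f (U z.1, V ω) * starRingEnd ℂ (f (U z.2, V ω)) ∂P ∂(P.prod P) := by
  have h1 : P[W | MeasurableSpace.comap V inferInstance] =ᵐ[P]
      fun ω ↦ ∫ ω', f (U ω', V ω) ∂P :=
    (condExp_congr_ae hW).trans (condExp_ae_eq_integral_of_indepFun hU hV hUV hf hC).symm
  have h2 : ∫ ω, ‖(P[W | MeasurableSpace.comap V inferInstance]) ω‖ ^ 2 ∂P =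
      ∫ ω, ‖∫ ω', f (U ω', V ω) ∂P‖ ^ 2 ∂P := by
    refine integral_congr_ae ?_
    filter_upwards [h1] with ω hω
    rw [hω]
  rw [h2, ← integral_complex_ofReal, integral_integral_swap]
  · congr 1 with ω
    -- `|∫ f|² = ∫∫ f(u) conj f(u')`, the two integration variables being the two copies.
    rw [integral_prod_mul (fun ω' ↦ f (U ω', V ω)) (fun ω' ↦ starRingEnd ℂ (f (U ω', V ω))),
      integral_conj, Complex.mul_conj']
    simp
  · refine .of_bound (C := C * C) (Measurable.aestronglyMeasurable ?_) (ae_of_all _ fun z ↦ ?_)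
    · refine (hf.comp (by fun_prop)).mul (Complex.continuous_conj.measurable.comp
        (hf.comp (by fun_prop)))
    · rw [Function.uncurry, norm_mul, RCLike.norm_conj]
      exact mul_le_mul (hC _) (hC _) (norm_nonneg _) ((norm_nonneg _).trans (hC (U z.1.1, V z.2)))

end indep

omit [MeasurableSpace Ω] in
lemma expi_mul_conj (s : ℝ) (f g : Ω → ℝ) (ω : Ω) :
    expi s f ω * starRingEnd ℂ (expi s g ω) = expi s (fun ω ↦ f ω - g ω) ω := by
  simp only [expi, ← Complex.exp_conj, map_mul, Complex.conj_I, Complex.conj_ofReal,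
    ← Complex.exp_add]
  congr 1
  push_cast
  ring

/-- The kernel `exp(-s² r² / 2)`. -/
def gaussKernel (s r : ℝ) : ℝ := Real.exp (-(s ^ 2 * r ^ 2 / 2))

/-- The two factors depend on `B₁` and on `B₂` only, so the expectation splits into two Gaussian
characteristic functions. -/
lemma integral_expi_mul_expi {B₁ B₂ : I → Ω → ℝ} (hB₁ : IsBrownianUnit P B₁)
    (hB₂ : IsBrownianUnit P B₂) (hB : IndepFun (path B₁) (path B₂) P) {h₁ h₂ : L2I}
    {g₁ g₂ : (I → ℝ) → ℝ} (hg₁ : Measurable g₁) (hg₂ : Measurable g₂)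
    (H₁ : IsWienerIntegral P B₁ h₁ (g₁ ∘ path B₁)) (H₂ : IsWienerIntegral P B₂ h₂ (g₂ ∘ path B₂))
    (s t : ℝ) :
    ∫ ω, expi s (g₁ ∘ path B₁) ω * expi t (g₂ ∘ path B₂) ω ∂P =
      (gaussKernel s ‖h₁‖ * gaussKernel t ‖h₂‖ : ℝ) := by
  have hm₁ : Measurable fun b ↦ Complex.exp (Complex.I * s * g₁ b) := by fun_prop
  have hm₂ : Measurable fun b ↦ Complex.exp (Complex.I * t * g₂ b) := by fun_prop
  have := (hB.comp hm₁ hm₂).integral_fun_mul_eq_mul_integral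
    (hm₁.comp hB₁.measurable_path).aestronglyMeasurable
    (hm₂.comp hB₂.measurable_path).aestronglyMeasurable
  rw [Complex.ofReal_mul]
  unfold gaussKernel
  rw [← H₁.integral_expi hB₁, ← H₂.integral_expi hB₂]
  exact this

lemma measurable_expi {s : ℝ} {Z : Ω → ℝ} (hZ : Measurable Z) : Measurable (expi s Z) := by
  unfold expi
  fun_prop

lemma integrable_expi_mul {s t : ℝ} {Z W : Ω → ℝ} (hZ : Measurable Z) (hW : Measurable W) :
    Integrable (fun ω ↦ expi s Z ω * expi t W ω) P :=
  .of_bound ((measurable_expi hZ).mul (measurable_expi hW)).aestronglyMeasurable 1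
    (ae_of_all _ fun ω ↦ by rw [norm_mul, norm_expi, norm_expi, one_mul])

lemma integral_sub_sub_add {α E : Type*} [MeasurableSpace α] {μ : Measure α}
    [NormedAddCommGroup E] [NormedSpace ℝ E] {f₁ f₂ f₃ f₄ : α → E} (h₁ : Integrable f₁ μ)
    (h₂ : Integrable f₂ μ) (h₃ : Integrable f₃ μ) (h₄ : Integrable f₄ μ) :
    ∫ a, (f₁ a - f₂ a - f₃ a + f₄ a) ∂μ =
      ∫ a, f₁ a ∂μ - ∫ a, f₂ a ∂μ - ∫ a, f₃ a ∂μ + ∫ a, f₄ a ∂μ := by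
  have h₁₂ : Integrable (fun a ↦ f₁ a - f₂ a) μ := h₁.sub h₂
  have h₁₂₃ : Integrable (fun a ↦ f₁ a - f₂ a - f₃ a) μ := h₁₂.sub h₃
  rw [← integral_sub h₁ h₂, ← integral_sub h₁₂ h₃, ← integral_add h₁₂₃ h₄]

/-- The second moment of the conditional difference in terms of two independent copies. -/
lemma condDiffSq_eq_integral {X Y Y' B₁ B₂ : I → Ω → ℝ}
    (hX : IsAdmissible P X) (hY : IsAdmissible P Y)
    (hB₁ : IsBrownianUnit P B₁) (hB₂ : IsBrownianUnit P B₂)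
    (hB : IndepFun (path B₁) (path B₂) P)
    (hXYB : IndepFun (fun ω ↦ (path X ω, path Y ω)) (fun ω ↦ (path B₁ ω, path B₂ ω)) P)
    (hY' : IsAdmissible P Y')
    (hY'ind : IndepFun (path Y')
      (fun ω ↦ ((path X ω, path Y ω), (path B₁ ω, path B₂ ω))) P) (s t : ℝ) :
    condDiffSq P X Y Y' B₁ B₂ s t = ∫ z : Ω × Ω,
      (gaussKernel s ‖pathLp X z.1 - pathLp X z.2‖ * gaussKernel t ‖pathLp Y z.1 - pathLp Y z.2‖
      - gaussKernel s ‖pathLp X z.1 - pathLp X z.2‖ * gaussKernel t ‖pathLp Y z.1 - pathLp Y' z.2‖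
      - gaussKernel s ‖pathLp X z.1 - pathLp X z.2‖ * gaussKernel t ‖pathLp Y' z.1 - pathLp Y z.2‖
      + gaussKernel s ‖pathLp X z.1 - pathLp X z.2‖ *
          gaussKernel t ‖pathLp Y' z.1 - pathLp Y' z.2‖) ∂(P.prod P) := by
  have mX := hX.measurable_path
  have mY := hY.measurable_path
  have mY' := hY'.measurable_path
  have m₁ := hB₁.measurable_path
  have m₂ := hB₂.measurable_path
  have iX : IndepFun (path X) (path B₁) P := hXYB.comp measurable_fst measurable_fst
  have iY : IndepFun (path Y) (path B₂) P := hXYB.comp measurable_snd measurable_snd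
  have iY' : IndepFun (path Y') (path B₂) P :=
    hY'ind.comp measurable_id (measurable_snd.comp measurable_snd)
  obtain ⟨J₁, hJ₁, eJ₁, wJ₁⟩ :=
    (isStochIntegral_stochIntegral hX hB₁ iX).exists_measurable hX hB₁ iX
  obtain ⟨J₂, hJ₂, eJ₂, wJ₂⟩ :=
    (isStochIntegral_stochIntegral hY hB₂ iY).exists_measurable hY hB₂ iY
  obtain ⟨J₃, hJ₃, eJ₃, wJ₃⟩ :=
    (isStochIntegral_stochIntegral hY' hB₂ iY').exists_measurable hY' hB₂ iY'
  have iUV : IndepFun (fun ω ↦ (path Y' ω, (path X ω, path Y ω)))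
      (fun ω ↦ (path B₁ ω, path B₂ ω)) P :=
    indepFun_prodMk_of_indepFun mY' (mX.prodMk mY) (m₁.prodMk m₂) hY'ind hXYB
  set f : ((I → ℝ) × (I → ℝ) × (I → ℝ)) × ((I → ℝ) × (I → ℝ)) → ℂ := fun z ↦
    expi s (fun z ↦ J₁ (z.1.2.1, z.2.1)) z * expi t (fun z ↦ J₂ (z.1.2.2, z.2.2)) z
    - expi s (fun z ↦ J₁ (z.1.2.1, z.2.1)) z * expi t (fun z ↦ J₃ (z.1.1, z.2.2)) z with hf
  have mf : Measurable f := by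
    refine Measurable.sub (Measurable.mul ?_ ?_) (Measurable.mul ?_ ?_) <;>
      refine measurable_expi ?_
    · exact hJ₁.comp (by fun_prop)
    · exact hJ₂.comp (by fun_prop)
    · exact hJ₁.comp (by fun_prop)
    · exact hJ₃.comp (by fun_prop)
  have bf z : ‖f z‖ ≤ 2 := by
    refine (norm_sub_le _ _).trans ?_
    simp only [norm_mul, norm_expi]
    norm_num
  have main := integral_norm_condExp_sq (mY'.prodMk (mX.prodMk mY)) (m₁.prodMk m₂) iUV mf bf
    (W := fun ω ↦ expi s (stochIntegral P X B₁) ω * expi t (stochIntegral P Y B₂) ω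
      - expi s (stochIntegral P X B₁) ω * expi t (stochIntegral P Y' B₂) ω) (by
      filter_upwards [eJ₁, eJ₂, eJ₃] with ω h1 h2 h3
      simp only [hf, expi, h1, h2, h3])
  rw [← Complex.ofReal_inj, condDiffSq]
  refine main.trans ?_
  rw [← integral_complex_ofReal]
  refine integral_congr_ae ?_
  filter_upwards [Measure.quasiMeasurePreserving_fst.ae wJ₁,
    Measure.quasiMeasurePreserving_snd.ae wJ₁, Measure.quasiMeasurePreserving_fst.ae wJ₂,
    Measure.quasiMeasurePreserving_snd.ae wJ₂, Measure.quasiMeasurePreserving_fst.ae wJ₃,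
    Measure.quasiMeasurePreserving_snd.ae wJ₃] with z a₁ a₂ b₁ b₂ c₁ c₂
  set x : (I → ℝ) → ℝ := fun b ↦ J₁ (path X z.1, b) - J₁ (path X z.2, b) with hx
  set y₁ : (I → ℝ) → ℝ := fun b ↦ J₂ (path Y z.1, b) - J₂ (path Y z.2, b) with hy₁
  set y₂ : (I → ℝ) → ℝ := fun b ↦ J₂ (path Y z.1, b) - J₃ (path Y' z.2, b) with hy₂
  set y₃ : (I → ℝ) → ℝ := fun b ↦ J₃ (path Y' z.1, b) - J₂ (path Y z.2, b) with hy₃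
  set y₄ : (I → ℝ) → ℝ := fun b ↦ J₃ (path Y' z.1, b) - J₃ (path Y' z.2, b) with hy₄
  have mx : Measurable x :=
    (hJ₁.comp measurable_prodMk_left).sub (hJ₁.comp measurable_prodMk_left)
  have my₁ : Measurable y₁ :=
    (hJ₂.comp measurable_prodMk_left).sub (hJ₂.comp measurable_prodMk_left)
  have my₂ : Measurable y₂ :=
    (hJ₂.comp measurable_prodMk_left).sub (hJ₃.comp measurable_prodMk_left)
  have my₃ : Measurable y₃ :=
    (hJ₃.comp measurable_prodMk_left).sub (hJ₂.comp measurable_prodMk_left)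
  have my₄ : Measurable y₄ :=
    (hJ₃.comp measurable_prodMk_left).sub (hJ₃.comp measurable_prodMk_left)
  have expand (ω : Ω) : f ((path Y' z.1, (path X z.1, path Y z.1)), (path B₁ ω, path B₂ ω)) *
      starRingEnd ℂ (f ((path Y' z.2, (path X z.2, path Y z.2)), (path B₁ ω, path B₂ ω))) =
      expi s (x ∘ path B₁) ω * expi t (y₁ ∘ path B₂) ω
      - expi s (x ∘ path B₁) ω * expi t (y₂ ∘ path B₂) ω
      - expi s (x ∘ path B₁) ω * expi t (y₃ ∘ path B₂) ω
      + expi s (x ∘ path B₁) ω * expi t (y₄ ∘ path B₂) ω := by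
    have ex := expi_mul_conj s (fun ω ↦ J₁ (path X z.1, path B₁ ω))
      (fun ω ↦ J₁ (path X z.2, path B₁ ω)) ω
    have e₁ := expi_mul_conj t (fun ω ↦ J₂ (path Y z.1, path B₂ ω))
      (fun ω ↦ J₂ (path Y z.2, path B₂ ω)) ω
    have e₂ := expi_mul_conj t (fun ω ↦ J₂ (path Y z.1, path B₂ ω))
      (fun ω ↦ J₃ (path Y' z.2, path B₂ ω)) ω
    have e₃ := expi_mul_conj t (fun ω ↦ J₃ (path Y' z.1, path B₂ ω))
      (fun ω ↦ J₂ (path Y z.2, path B₂ ω)) ω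
    have e₄ := expi_mul_conj t (fun ω ↦ J₃ (path Y' z.1, path B₂ ω))
      (fun ω ↦ J₃ (path Y' z.2, path B₂ ω)) ω
    simp only [hf, map_sub, map_mul]
    rw [show expi s (x ∘ path B₁) ω = _ from ex.symm, show expi t (y₁ ∘ path B₂) ω = _ from e₁.symm,
      show expi t (y₂ ∘ path B₂) ω = _ from e₂.symm, show expi t (y₃ ∘ path B₂) ω = _ from e₃.symm,
      show expi t (y₄ ∘ path B₂) ω = _ from e₄.symm]
    simp only [expi]
    ring
  have hint {y : (I → ℝ) → ℝ} (my : Measurable y) : Integrable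
      (fun ω ↦ expi s (x ∘ path B₁) ω * expi t (y ∘ path B₂) ω) P :=
    integrable_expi_mul (mx.comp m₁) (my.comp m₂)
  simp_rw [expand]
  -- The functionals `J₂` and `J₃` come from separate choices. The mixed terms need only that a
  -- difference of Wiener integrals is the Wiener integral of the difference.
  rw [integral_sub_sub_add (hint my₁) (hint my₂) (hint my₃) (hint my₄),
    integral_expi_mul_expi hB₁ hB₂ hB mx my₁ (a₁.sub a₂) (b₁.sub b₂),
    integral_expi_mul_expi hB₁ hB₂ hB mx my₂ (a₁.sub a₂) (b₁.sub c₂),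
    integral_expi_mul_expi hB₁ hB₂ hB mx my₃ (a₁.sub a₂) (c₁.sub b₂),
    integral_expi_mul_expi hB₁ hB₂ hB mx my₄ (a₁.sub a₂) (c₁.sub c₂)]
  push_cast
  ring

end

/-! ### Replacing `Y'` by further iid copies, and passing from `g` to `1 - g` -/

section

variable {Ω : Type*} [MeasurableSpace Ω] {P : Measure Ω} [IsProbabilityMeasure P]

section copies

variable {E F : Type*} [MeasurableSpace E] [MeasurableSpace F] {ξ : Ω → E} {η η' : Ω → F}

/-- Both sides integrate against the product of the laws of `ξ` and `η`: an independent copy on the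
same space is traded for a new sample point. -/
lemma integral_eq_integral_copy (hξ : Measurable ξ) (hη : Measurable η) (hη' : Measurable η')
    (hind : IndepFun ξ η' P) (hlaw : P.map η' = P.map η) {f : E × F → ℝ} (hf : Measurable f) :
    ∫ ω, f (ξ ω, η' ω) ∂P = ∫ z : Ω × Ω, f (ξ z.1, η z.2) ∂(P.prod P) := by
  rw [← integral_map (φ := fun ω ↦ (ξ ω, η' ω)) (hξ.prodMk hη').aemeasurable
      hf.aestronglyMeasurable,
    (indepFun_iff_map_prod_eq_prod_map_map hξ.aemeasurable hη'.aemeasurable).1 hind, hlaw,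
    Measure.map_prod_map _ _ hξ hη, integral_map (hξ.prodMap hη).aemeasurable
      hf.aestronglyMeasurable]
  rfl

variable {a : E × E → ℝ} {b : F × F → ℝ}

lemma integrable_mul_of_abs_le {α : Type*} [MeasurableSpace α] {μ : Measure α} [IsFiniteMeasure μ]
    {f g : α → ℝ} (hf : Measurable f) (hg : Measurable g) (hf1 : ∀ x, |f x| ≤ 1)
    (hg1 : ∀ x, |g x| ≤ 1) : Integrable (fun x ↦ f x * g x) μ :=
  .of_bound (hf.mul hg).aestronglyMeasurable 1 (ae_of_all _ fun x ↦ by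
    rw [Real.norm_eq_abs, abs_mul]
    exact mul_le_one₀ (hf1 x) (abs_nonneg _) (hg1 x))

lemma integral_mul_copy_right (hξ : Measurable ξ) (hη : Measurable η) (hη' : Measurable η')
    (hind : IndepFun ξ η' P) (hlaw : P.map η' = P.map η) (ha : Measurable a) (hb : Measurable b)
    (ha1 : ∀ x, |a x| ≤ 1) (hb1 : ∀ x, |b x| ≤ 1) :
    ∫ z : Ω × Ω, a (ξ z.1, ξ z.2) * b (η z.1, η' z.2) ∂(P.prod P) =
      ∫ z : Ω × Ω × Ω, a (ξ z.1, ξ z.2.1) * b (η z.1, η z.2.2) ∂(P.prod (P.prod P)) := by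
  rw [integral_prod, integral_prod]
  · congr 1 with ω
    exact integral_eq_integral_copy hξ hη hη' hind hlaw
      (f := fun z ↦ a (ξ ω, z.1) * b (η ω, z.2)) (by fun_prop)
  · exact integrable_mul_of_abs_le (by fun_prop) (by fun_prop) (fun _ ↦ ha1 _) (fun _ ↦ hb1 _)
  · exact integrable_mul_of_abs_le (by fun_prop) (by fun_prop) (fun _ ↦ ha1 _) (fun _ ↦ hb1 _)

/-- Exchanging the two sample points reduces to the previous case, as both kernels are symmetric. -/
lemma integral_mul_copy_left (hξ : Measurable ξ) (hη : Measurable η) (hη' : Measurable η')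
    (hind : IndepFun ξ η' P) (hlaw : P.map η' = P.map η) (ha : Measurable a) (hb : Measurable b)
    (ha1 : ∀ x, |a x| ≤ 1) (hb1 : ∀ x, |b x| ≤ 1) (has : ∀ x y, a (x, y) = a (y, x))
    (hbs : ∀ x y, b (x, y) = b (y, x)) :
    ∫ z : Ω × Ω, a (ξ z.1, ξ z.2) * b (η' z.1, η z.2) ∂(P.prod P) =
      ∫ z : Ω × Ω × Ω, a (ξ z.1, ξ z.2.1) * b (η z.1, η z.2.2) ∂(P.prod (P.prod P)) := by
  rw [← integral_mul_copy_right hξ hη hη' hind hlaw ha hb ha1 hb1, ← integral_prod_swap]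
  refine integral_congr_ae (ae_of_all _ fun z ↦ ?_)
  simp only [Prod.fst_swap, Prod.snd_swap]
  rw [has, hbs]

/-- The copy is traded twice: in the inner integral with the first sample point fixed, then in the
outer one. After that everything factorises. -/
lemma integral_mul_copy_copy (hξ : Measurable ξ) (hη : Measurable η) (hη' : Measurable η')
    (hind : IndepFun ξ η' P) (hlaw : P.map η' = P.map η) (ha : Measurable a) (hb : Measurable b)
    (ha1 : ∀ x, |a x| ≤ 1) (hb1 : ∀ x, |b x| ≤ 1) :
    ∫ z : Ω × Ω, a (ξ z.1, ξ z.2) * b (η' z.1, η' z.2) ∂(P.prod P) =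
      (∫ z : Ω × Ω, a (ξ z.1, ξ z.2) ∂(P.prod P)) *
        ∫ z : Ω × Ω, b (η z.1, η z.2) ∂(P.prod P) := by
  have ia : Integrable (fun z : Ω × Ω ↦ a (ξ z.1, ξ z.2)) (P.prod P) :=
    .of_bound (Measurable.aestronglyMeasurable (by fun_prop)) 1 (ae_of_all _ fun _ ↦ ha1 _)
  have ib : Integrable (fun z : Ω × Ω ↦ b (η z.1, η z.2)) (P.prod P) :=
    .of_bound (Measurable.aestronglyMeasurable (by fun_prop)) 1 (ae_of_all _ fun _ ↦ hb1 _)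
  rw [integral_prod _ (integrable_mul_of_abs_le (by fun_prop) (by fun_prop) (fun _ ↦ ha1 _)
    (fun _ ↦ hb1 _))]
  have h1 (ω : Ω) : ∫ ω', a (ξ ω, ξ ω') * b (η' ω, η' ω') ∂P =
      (∫ ω', a (ξ ω, ξ ω') ∂P) * ∫ ω', b (η' ω, η ω') ∂P := by
    rw [integral_eq_integral_copy hξ hη hη' hind hlaw
      (f := fun z ↦ a (ξ ω, z.1) * b (η' ω, z.2)) (by fun_prop)]
    exact integral_prod_mul (fun ω' ↦ a (ξ ω, ξ ω')) fun ω' ↦ b (η' ω, η ω')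
  simp_rw [h1]
  have ma : Measurable fun x ↦ ∫ ω', a (x, ξ ω') ∂P :=
    (StronglyMeasurable.integral_prod_right' (f := fun z : E × Ω ↦ a (z.1, ξ z.2))
      (by fun_prop : Measurable _).stronglyMeasurable).measurable
  have mb : Measurable fun x ↦ ∫ ω', b (x, η ω') ∂P :=
    (StronglyMeasurable.integral_prod_right' (f := fun z : F × Ω ↦ b (z.1, η z.2))
      (by fun_prop : Measurable _).stronglyMeasurable).measurable
  rw [integral_eq_integral_copy hξ hη hη' hind hlaw
      (f := fun z ↦ (∫ ω', a (z.1, ξ ω') ∂P) * ∫ ω', b (z.2, η ω') ∂P)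
      ((ma.comp measurable_fst).mul (mb.comp measurable_snd)),
    integral_prod _ ia, integral_prod _ ib]
  exact integral_prod_mul (fun ω ↦ ∫ ω', a (ξ ω, ξ ω') ∂P) fun ω ↦ ∫ ω', b (η ω, η ω') ∂P

end copies

lemma integral_one_sub_mul_one_sub {α : Type*} [MeasurableSpace α] {μ : Measure α}
    [IsProbabilityMeasure μ] {f g : α → ℝ} (hf : Measurable f) (hg : Measurable g)
    (hf1 : ∀ x, |f x| ≤ 1) (hg1 : ∀ x, |g x| ≤ 1) :
    ∫ x, (1 - f x) * (1 - g x) ∂μ =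
      1 - ∫ x, f x ∂μ - ∫ x, g x ∂μ + ∫ x, f x * g x ∂μ := by
  have i1 : Integrable f μ := .of_bound hf.aestronglyMeasurable 1 (ae_of_all _ hf1)
  have i2 : Integrable g μ := .of_bound hg.aestronglyMeasurable 1 (ae_of_all _ hg1)
  have := integral_sub_sub_add (integrable_const (μ := μ) (1 : ℝ)) i1 i2
    (integrable_mul_of_abs_le hf hg hf1 hg1)
  rw [integral_const] at this
  simp only [probReal_univ, one_smul] at this
  rw [← this]
  congr 1 with x
  ring

lemma continuous_gaussKernel (s : ℝ) : Continuous (gaussKernel s) := by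
  unfold gaussKernel
  fun_prop

lemma gaussKernel_nonneg (s r : ℝ) : 0 ≤ gaussKernel s r := (Real.exp_pos _).le

lemma gaussKernel_le_one (s r : ℝ) : gaussKernel s r ≤ 1 :=
  Real.exp_le_one_iff.2 (neg_nonpos.2 (by positivity))

/-- The second moment of the conditional difference as a distance covariance type expression. -/
lemma condDiffSq_eq {X Y Y' B₁ B₂ : I → Ω → ℝ}
    (hX : IsAdmissible P X) (hY : IsAdmissible P Y)
    (hB₁ : IsBrownianUnit P B₁) (hB₂ : IsBrownianUnit P B₂)
    (hB : IndepFun (path B₁) (path B₂) P)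
    (hXYB : IndepFun (fun ω ↦ (path X ω, path Y ω)) (fun ω ↦ (path B₁ ω, path B₂ ω)) P)
    (hY' : IsAdmissible P Y')
    (hY'ind : IndepFun (path Y')
      (fun ω ↦ ((path X ω, path Y ω), (path B₁ ω, path B₂ ω))) P)
    {ξ η η' : Ω → L2I} (hξ : Measurable ξ) (hη : Measurable η) (hη' : Measurable η')
    (hind : IndepFun ξ η' P) (hlaw : P.map η' = P.map η) (eξ : pathLp X =ᵐ[P] ξ)
    (eη : pathLp Y =ᵐ[P] η) (eη' : pathLp Y' =ᵐ[P] η') (s t : ℝ) :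
    condDiffSq P X Y Y' B₁ B₂ s t =
      ∫ z : Ω × Ω, (1 - gaussKernel s ‖ξ z.1 - ξ z.2‖) * (1 - gaussKernel t ‖η z.1 - η z.2‖)
        ∂(P.prod P)
      + ∫ z : (Ω × Ω) × (Ω × Ω), (1 - gaussKernel s ‖ξ z.1.1 - ξ z.1.2‖) *
        (1 - gaussKernel t ‖η z.2.1 - η z.2.2‖) ∂((P.prod P).prod (P.prod P))
      - 2 * ∫ z : Ω × Ω × Ω, (1 - gaussKernel s ‖ξ z.1 - ξ z.2.1‖) *
        (1 - gaussKernel t ‖η z.1 - η z.2.2‖) ∂(P.prod (P.prod P)) := by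
  set k : ℝ → L2I × L2I → ℝ := fun s x ↦ gaussKernel s ‖x.1 - x.2‖ with hk
  have mk s : Measurable (k s) :=
    (continuous_gaussKernel s).measurable.comp (measurable_fst.sub measurable_snd).norm
  have k1 s x : |k s x| ≤ 1 := by
    rw [abs_of_nonneg (gaussKernel_nonneg _ _)]
    exact gaussKernel_le_one _ _
  have ks s x y : k s (x, y) = k s (y, x) := by
    simp only [hk]
    rw [norm_sub_rev]
  have ms := mk s
  have mt := mk t
  have e1 : condDiffSq P X Y Y' B₁ B₂ s t = ∫ z : Ω × Ω,
      (k s (ξ z.1, ξ z.2) * k t (η z.1, η z.2) - k s (ξ z.1, ξ z.2) * k t (η z.1, η' z.2)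
      - k s (ξ z.1, ξ z.2) * k t (η' z.1, η z.2) + k s (ξ z.1, ξ z.2) * k t (η' z.1, η' z.2))
      ∂(P.prod P) := by
    rw [condDiffSq_eq_integral hX hY hB₁ hB₂ hB hXYB hY' hY'ind]
    refine integral_congr_ae ?_
    filter_upwards [Measure.quasiMeasurePreserving_fst.ae eξ,
      Measure.quasiMeasurePreserving_snd.ae eξ, Measure.quasiMeasurePreserving_fst.ae eη,
      Measure.quasiMeasurePreserving_snd.ae eη, Measure.quasiMeasurePreserving_fst.ae eη',
      Measure.quasiMeasurePreserving_snd.ae eη'] with z a₁ a₂ b₁ b₂ c₁ c₂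
    simp only [hk, a₁, a₂, b₁, b₂, c₁, c₂]
  rw [integral_sub_sub_add
    (integrable_mul_of_abs_le (by fun_prop) (by fun_prop) (fun _ ↦ k1 _ _) fun _ ↦ k1 _ _)
    (integrable_mul_of_abs_le (by fun_prop) (by fun_prop) (fun _ ↦ k1 _ _) fun _ ↦ k1 _ _)
    (integrable_mul_of_abs_le (by fun_prop) (by fun_prop) (fun _ ↦ k1 _ _) fun _ ↦ k1 _ _)
    (integrable_mul_of_abs_le (by fun_prop) (by fun_prop) (fun _ ↦ k1 _ _) fun _ ↦ k1 _ _),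
    integral_mul_copy_right hξ hη hη' hind hlaw ms mt (k1 s) (k1 t),
    integral_mul_copy_left hξ hη hη' hind hlaw ms mt (k1 s) (k1 t) (ks s) (ks t),
    integral_mul_copy_copy hξ hη hη' hind hlaw ms mt (k1 s) (k1 t)] at e1
  -- Expand the three products `(1 - g)(1 - g)`. In `f1 + f2 - 2 f3` the constants and single-kernel
  -- integrals cancel, as the marginals `g2` to `g5` agree.
  have f1 := integral_one_sub_mul_one_sub (μ := P.prod P)
    (f := fun z ↦ k s (ξ z.1, ξ z.2)) (g := fun z ↦ k t (η z.1, η z.2))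
    (by fun_prop) (by fun_prop) (fun _ ↦ k1 _ _) fun _ ↦ k1 _ _
  have f2 := integral_one_sub_mul_one_sub (μ := (P.prod P).prod (P.prod P))
    (f := fun z ↦ k s (ξ z.1.1, ξ z.1.2)) (g := fun z ↦ k t (η z.2.1, η z.2.2))
    (by fun_prop) (by fun_prop) (fun _ ↦ k1 _ _) fun _ ↦ k1 _ _
  have f3 := integral_one_sub_mul_one_sub (μ := P.prod (P.prod P))
    (f := fun z ↦ k s (ξ z.1, ξ z.2.1)) (g := fun z ↦ k t (η z.1, η z.2.2))
    (by fun_prop) (by fun_prop) (fun _ ↦ k1 _ _) fun _ ↦ k1 _ _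
  have g1 : ∫ z : (Ω × Ω) × (Ω × Ω), k s (ξ z.1.1, ξ z.1.2) * k t (η z.2.1, η z.2.2)
      ∂((P.prod P).prod (P.prod P)) = (∫ z : Ω × Ω, k s (ξ z.1, ξ z.2) ∂(P.prod P)) *
        ∫ z : Ω × Ω, k t (η z.1, η z.2) ∂(P.prod P) :=
    integral_prod_mul (fun z : Ω × Ω ↦ k s (ξ z.1, ξ z.2)) fun z : Ω × Ω ↦ k t (η z.1, η z.2)
  have g2 : ∫ z : (Ω × Ω) × (Ω × Ω), k s (ξ z.1.1, ξ z.1.2) ∂((P.prod P).prod (P.prod P)) =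
      ∫ z : Ω × Ω, k s (ξ z.1, ξ z.2) ∂(P.prod P) := by
    simpa using integral_fun_fst (μ := P.prod P) (ν := P.prod P)
      fun z : Ω × Ω ↦ k s (ξ z.1, ξ z.2)
  have g3 : ∫ z : (Ω × Ω) × (Ω × Ω), k t (η z.2.1, η z.2.2) ∂((P.prod P).prod (P.prod P)) =
      ∫ z : Ω × Ω, k t (η z.1, η z.2) ∂(P.prod P) := by
    simpa using integral_fun_snd (μ := P.prod P) (ν := P.prod P)
      fun z : Ω × Ω ↦ k t (η z.1, η z.2)
  have p1 : MeasurePreserving (Prod.map id Prod.fst : Ω × Ω × Ω → Ω × Ω) (P.prod (P.prod P))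
      (P.prod P) := (MeasurePreserving.id P).prod measurePreserving_fst
  have p2 : MeasurePreserving (Prod.map id Prod.snd : Ω × Ω × Ω → Ω × Ω) (P.prod (P.prod P))
      (P.prod P) := (MeasurePreserving.id P).prod measurePreserving_snd
  have g4 : ∫ z : Ω × Ω × Ω, k s (ξ z.1, ξ z.2.1) ∂(P.prod (P.prod P)) =
      ∫ z : Ω × Ω, k s (ξ z.1, ξ z.2) ∂(P.prod P) := by
    have := integral_map (μ := P.prod (P.prod P)) p1.measurable.aemeasurable (f := fun z ↦ k s (ξ z.1, ξ z.2))
      (Measurable.aestronglyMeasurable (by fun_prop))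
    rw [p1.map_eq] at this
    exact this.symm
  have g5 : ∫ z : Ω × Ω × Ω, k t (η z.1, η z.2.2) ∂(P.prod (P.prod P)) =
      ∫ z : Ω × Ω, k t (η z.1, η z.2) ∂(P.prod P) := by
    have := integral_map (μ := P.prod (P.prod P)) p2.measurable.aemeasurable (f := fun z ↦ k t (η z.1, η z.2))
      (Measurable.aestronglyMeasurable (by fun_prop))
    rw [p2.map_eq] at this
    exact this.symm
  rw [g1, g2, g3] at f2
  rw [g4, g5] at f3
  simp only [hk] at e1 f1 f2 f3 ⊢
  rw [f1, f2, f3, e1]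
  ring

end

/-! ### The constant `c₀`, its scaling, and Fubini -/

section

lemma c0Integrand_nonneg (β s : ℝ) : 0 ≤ c0Integrand β s := by
  refine div_nonneg (sub_nonneg.2 (Real.exp_le_one_iff.2 ?_)) (by positivity)
  exact neg_nonpos.2 (by positivity)

lemma measurable_c0Integrand (β : ℝ) : Measurable (c0Integrand β) := by
  unfold c0Integrand
  fun_prop

/-- Near `0`, `1 - exp(-s²/2) ≤ s²/2` gives the bound `s^(1-β)`, integrable since `β < 2`. Beyond
`1` the bound is `s^(-(1+β))`, integrable since `β > 0`. The negative half-line follows by evenness.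
-/
lemma integrable_c0Integrand {β : ℝ} (hβ0 : 0 < β) (hβ2 : β < 2) :
    Integrable (c0Integrand β) := by
  have h1 : IntegrableOn (c0Integrand β) (Set.Ioc 0 1) := by
    have h := (intervalIntegral.intervalIntegrable_rpow' (a := 0) (b := 1)
      (show -1 < 1 - β by linarith)).1
    refine Integrable.mono' h (measurable_c0Integrand β).aestronglyMeasurable ?_
    filter_upwards [ae_restrict_mem measurableSet_Ioc] with s hs'
    have hs : 0 < s := hs'.1
    rw [Real.norm_of_nonneg (c0Integrand_nonneg β s), c0Integrand, abs_of_pos hs,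
      div_le_iff₀ (by positivity), ← Real.rpow_add hs]
    ring_nf
    have := Real.add_one_le_exp (-(s ^ 2 / 2))
    rw [Real.rpow_ofNat]
    have e : s ^ 2 * (-1 / 2) = -(s ^ 2 / 2) := by ring
    rw [e]
    nlinarith [sq_nonneg s]
  have h2 : IntegrableOn (c0Integrand β) (Set.Ioi 1) := by
    have h := integrableOn_Ioi_rpow_of_lt (show -(1 + β) < -1 by linarith) one_pos
    refine Integrable.mono' h (measurable_c0Integrand β).aestronglyMeasurable ?_
    filter_upwards [ae_restrict_mem measurableSet_Ioi] with s hs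
    have hs0 : 0 < s := one_pos.trans hs
    rw [Real.norm_of_nonneg (c0Integrand_nonneg β s), c0Integrand, abs_of_pos hs0,
      Real.rpow_neg hs0.le, ← one_div]
    gcongr
    linarith [Real.exp_pos (-(s ^ 2 / 2))]
  have h3 : IntegrableOn (c0Integrand β) (Set.Ioi 0) := by
    rw [← Set.Ioc_union_Ioi_eq_Ioi zero_le_one]
    exact h1.union h2
  have h4 : IntegrableOn (c0Integrand β) (Set.Iio 0) := by
    have := ((Measure.measurePreserving_neg (volume : Measure ℝ)).integrableOn_comp_preimage
      (Homeomorph.neg ℝ).measurableEmbedding).2 h3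
    convert this using 1
    · ext s
      simp [c0Integrand]
    · ext s
      simp
  rw [← integrableOn_univ, ← Set.Iic_union_Ioi (a := (0 : ℝ))]
  exact ((integrableOn_Iic_iff_integrableOn_Iio (by simp)).2 h4).union h3

/-- The function whose integral in `s` is `c₀ r ^ β`. -/
def c0Kernel (β s r : ℝ) : ℝ := |s| ^ (-(1 + β)) * (1 - gaussKernel s r)

lemma c0Kernel_nonneg (β s r : ℝ) : 0 ≤ c0Kernel β s r :=
  mul_nonneg (by positivity) (sub_nonneg.2 (gaussKernel_le_one s r))

lemma measurable_c0Kernel (β : ℝ) : Measurable fun z : ℝ × ℝ ↦ c0Kernel β z.1 z.2 := by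
  unfold c0Kernel gaussKernel
  fun_prop

lemma c0Kernel_zero (β s : ℝ) : c0Kernel β s 0 = 0 := by simp [c0Kernel, gaussKernel]

lemma c0Kernel_eq {β r : ℝ} (hr : 0 < r) (s : ℝ) :
    c0Kernel β s r = r ^ (1 + β) * c0Integrand β (r * s) := by
  have := Real.rpow_pos_of_pos hr (1 + β)
  rw [c0Kernel, c0Integrand, abs_mul, abs_of_pos hr, Real.mul_rpow hr.le (abs_nonneg s),
    Real.rpow_neg (abs_nonneg s), gaussKernel, mul_pow, mul_comm (r ^ 2)]
  field_simp

lemma integrable_c0Kernel {β : ℝ} (hβ0 : 0 < β) (hβ2 : β < 2) {r : ℝ} (hr : 0 ≤ r) :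
    Integrable fun s ↦ c0Kernel β s r := by
  rcases hr.eq_or_lt with rfl | hr
  · simp [c0Kernel_zero]
  · simp_rw [c0Kernel_eq hr]
    exact ((integrable_c0Integrand hβ0 hβ2).comp_mul_left' hr.ne').const_mul _

lemma integral_c0Kernel {β : ℝ} (hβ0 : 0 < β) {r : ℝ} (hr : 0 ≤ r) :
    ∫ s, c0Kernel β s r = c0 β * r ^ β := by
  rcases hr.eq_or_lt with rfl | hr
  -- At `r = 0` the kernel vanishes, matching `0 ^ β = 0` because `β ≠ 0`.
  · simp [c0Kernel_zero, Real.zero_rpow hβ0.ne']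
  · simp_rw [c0Kernel_eq hr]
    rw [integral_const_mul, Measure.integral_comp_mul_left, c0, abs_of_pos (inv_pos.2 hr),
      Real.rpow_add hr, Real.rpow_one, smul_eq_mul]
    field_simp

section moments

variable {α : Type*} [MeasurableSpace α] {μ : Measure α} [SFinite μ] {β : ℝ} {A B : α → ℝ}

/-- Nonnegativity of `c0Kernel` reduces joint integrability to that of `A^β B^β`. The general
measure `μ` lets all three terms of the distance covariance be handled at once. -/
lemma integrable_and_integral_kernel_mul (hβ0 : 0 < β) (hβ2 : β < 2) (hA : Measurable A)
    (hB : Measurable B) (hA0 : ∀ a, 0 ≤ A a) (hB0 : ∀ a, 0 ≤ B a)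
    (h : Integrable (fun a ↦ A a ^ β * B a ^ β) μ) :
    Integrable (fun p : ℝ × ℝ ↦ |p.1 * p.2| ^ (-(1 + β)) *
      ∫ a, (1 - gaussKernel p.1 (A a)) * (1 - gaussKernel p.2 (B a)) ∂μ) ∧
    ∫ p : ℝ × ℝ, |p.1 * p.2| ^ (-(1 + β)) *
      ∫ a, (1 - gaussKernel p.1 (A a)) * (1 - gaussKernel p.2 (B a)) ∂μ =
      c0 β ^ 2 * ∫ a, A a ^ β * B a ^ β ∂μ := by
  have e (p : ℝ × ℝ) : |p.1 * p.2| ^ (-(1 + β)) *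
      ∫ a, (1 - gaussKernel p.1 (A a)) * (1 - gaussKernel p.2 (B a)) ∂μ =
      ∫ a, c0Kernel β p.1 (A a) * c0Kernel β p.2 (B a) ∂μ := by
    rw [← integral_const_mul]
    congr 1 with a
    rw [abs_mul, Real.mul_rpow (abs_nonneg _) (abs_nonneg _), c0Kernel, c0Kernel]
    ring
  have e' (a : α) : ∫ p : ℝ × ℝ, c0Kernel β p.1 (A a) * c0Kernel β p.2 (B a) =
      c0 β ^ 2 * (A a ^ β * B a ^ β) := by
    rw [Measure.volume_eq_prod, integral_prod_mul (fun s ↦ c0Kernel β s (A a))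
      fun s ↦ c0Kernel β s (B a), integral_c0Kernel hβ0 (hA0 a), integral_c0Kernel hβ0 (hB0 a)]
    ring
  have hint : Integrable (fun z : (ℝ × ℝ) × α ↦
      c0Kernel β z.1.1 (A z.2) * c0Kernel β z.1.2 (B z.2)) (volume.prod μ) := by
    rw [integrable_prod_iff']
    · refine ⟨ae_of_all _ fun a ↦ ?_, ?_⟩
      · exact (integrable_c0Kernel hβ0 hβ2 (hA0 a)).mul_prod (integrable_c0Kernel hβ0 hβ2 (hB0 a))
      · simp_rw [Real.norm_of_nonneg (mul_nonneg (c0Kernel_nonneg _ _ _) (c0Kernel_nonneg _ _ _)),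
          e']
        exact h.const_mul _
    · have m := measurable_c0Kernel β
      exact ((m.comp (f := fun z : (ℝ × ℝ) × α ↦ (z.1.1, A z.2)) (by fun_prop)).mul
        (m.comp (f := fun z : (ℝ × ℝ) × α ↦ (z.1.2, B z.2)) (by fun_prop))).aestronglyMeasurable
  simp_rw [e]
  refine ⟨hint.integral_prod_left, ?_⟩
  rw [integral_integral_swap hint]
  simp_rw [e']
  exact integral_const_mul _ _

end moments

variable {Ω : Type*} [MeasurableSpace Ω] {P : Measure Ω} [IsProbabilityMeasure P]

/-- Bounding a sum by twice the maximum works uniformly for `β` below and above `1`. -/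
lemma integrable_norm_sub_rpow {β : ℝ} (hβ : 0 ≤ β) {ξ : Ω → L2I} (hξ : Measurable ξ)
    (h : Integrable (fun ω ↦ ‖ξ ω‖ ^ β) P) :
    Integrable (fun z : Ω × Ω ↦ ‖ξ z.1 - ξ z.2‖ ^ β) (P.prod P) := by
  refine Integrable.mono' (((h.comp_fst P).add (h.comp_snd P)).const_mul (2 ^ β))
    (Measurable.aestronglyMeasurable (by fun_prop)) (ae_of_all _ fun z ↦ ?_)
  rw [Real.norm_of_nonneg (by positivity)]
  calc ‖ξ z.1 - ξ z.2‖ ^ β ≤ (2 * max ‖ξ z.1‖ ‖ξ z.2‖) ^ β := by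
        gcongr
        refine (norm_sub_le _ _).trans ?_
        rw [two_mul]
        exact add_le_add (le_max_left _ _) (le_max_right _ _)
    _ = 2 ^ β * max ‖ξ z.1‖ ‖ξ z.2‖ ^ β := Real.mul_rpow (by norm_num) (by positivity)
    _ ≤ 2 ^ β * (‖ξ z.1‖ ^ β + ‖ξ z.2‖ ^ β) := by
        gcongr
        rcases max_choice ‖ξ z.1‖ ‖ξ z.2‖ with h | h <;> rw [h]
        · exact le_add_of_nonneg_right (by positivity)
        · exact le_add_of_nonneg_left (by positivity)

omit [IsProbabilityMeasure P] in
lemma IsAdmissible.pathDist_eq {X : I → Ω → ℝ} (hX : IsAdmissible P X) {ξ : Ω → L2I}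
    (eξ : pathLp X =ᵐ[P] ξ) :
    ∀ᵐ z : Ω × Ω ∂(P.prod P), pathDist X z.1 z.2 = ‖ξ z.1 - ξ z.2‖ := by
  filter_upwards [Measure.quasiMeasurePreserving_fst.ae eξ,
    Measure.quasiMeasurePreserving_snd.ae eξ, Measure.quasiMeasurePreserving_fst.ae hX.memLp,
    Measure.quasiMeasurePreserving_snd.ae hX.memLp] with z h₁ h₂ m₁ m₂
  rw [← h₁, ← h₂, norm_pathLp_sub m₁ m₂]
  rfl

end

end DistCov

end

/-! ### Assembly -/

theorem lemma4p1 {Ω : Type*} [MeasurableSpace Ω] (P : Measure Ω) [IsProbabilityMeasure P]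
    (β : ℝ) (hβ0 : 0 < β) (hβ2 : β < 2)
    (X Y Y' B₁ B₂ : unitInterval → Ω → ℝ)
    (hX : DistCov.IsAdmissible P X) (hY : DistCov.IsAdmissible P Y)
    -- `E[‖X‖₂^β] + E[‖Y‖₂^β] < ∞`
    (hXβ : Integrable (fun ω ↦ DistCov.l2norm (DistCov.path X ω) ^ β) P)
    (hYβ : Integrable (fun ω ↦ DistCov.l2norm (DistCov.path Y ω) ^ β) P)
    -- the mixed moments in the definition of the distance covariance are finite
    (hXY : Integrable (fun z : Ω × Ω ↦
      DistCov.pathDist X z.1 z.2 ^ β * DistCov.pathDist Y z.1 z.2 ^ β) (P.prod P))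
    (hXYY : Integrable (fun z : Ω × Ω × Ω ↦
      DistCov.pathDist X z.1 z.2.1 ^ β * DistCov.pathDist Y z.1 z.2.2 ^ β)
      (P.prod (P.prod P)))
    -- independent Brownian motions, independent of `(X, Y)`
    (hB₁ : DistCov.IsBrownianUnit P B₁) (hB₂ : DistCov.IsBrownianUnit P B₂)
    (hB : IndepFun (DistCov.path B₁) (DistCov.path B₂) P)
    (hXYB : IndepFun (fun ω ↦ (DistCov.path X ω, DistCov.path Y ω))
      (fun ω ↦ (DistCov.path B₁ ω, DistCov.path B₂ ω)) P)
    -- `Y'` is a copy of `Y`, independent of everything else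
    (hY' : DistCov.IsAdmissible P Y')
    (hYY' : IdentDistrib (DistCov.path Y') (DistCov.path Y) P P)
    (hY'ind : IndepFun (DistCov.path Y')
      (fun ω ↦ ((DistCov.path X ω, DistCov.path Y ω),
        (DistCov.path B₁ ω, DistCov.path B₂ ω))) P) :
    Integrable (DistCov.c0Integrand β) ∧
    Integrable (fun p : ℝ × ℝ ↦
      |p.1 * p.2| ^ (-(1 + β)) * DistCov.condDiffSq P X Y Y' B₁ B₂ p.1 p.2) ∧
    DistCov.c0 β ^ 2 * DistCov.distCov P β X Y =
      ∫ p : ℝ × ℝ, |p.1 * p.2| ^ (-(1 + β)) * DistCov.condDiffSq P X Y Y' B₁ B₂ p.1 p.2 := by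
  open DistCov in
  -- Pairing `X` with itself merely supplies an everywhere measurable version of its path in `L²`.
  obtain ⟨Φ, hΦ, eX, -⟩ := exists_measurable_pathLp_eq hX hX rfl
  obtain ⟨Ψ, hΨ, eY, eY'⟩ := exists_measurable_pathLp_eq hY hY' hYY'.map_eq
  set ξ := Φ ∘ path X
  set η := Ψ ∘ path Y
  set η' := Ψ ∘ path Y'
  have hξ : Measurable ξ := hΦ.comp hX.measurable_path
  have hη : Measurable η := hΨ.comp hY.measurable_path
  have hη' : Measurable η' := hΨ.comp hY'.measurable_path
  have hind : IndepFun ξ η' P :=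
    (hY'ind.symm.comp (measurable_fst.comp measurable_fst) measurable_id).comp hΦ hΨ
  have hlaw : P.map η' = P.map η := (hYY'.comp hΨ).map_eq
  have hdX := hX.pathDist_eq eX
  have hdY := hY.pathDist_eq eY
  have p1 : Measure.QuasiMeasurePreserving (Prod.map id Prod.fst : Ω × Ω × Ω → Ω × Ω)
      (P.prod (P.prod P)) (P.prod P) :=
    ((MeasurePreserving.id P).prod measurePreserving_fst).quasiMeasurePreserving
  have p2 : Measure.QuasiMeasurePreserving (Prod.map id Prod.snd : Ω × Ω × Ω → Ω × Ω)
      (P.prod (P.prod P)) (P.prod P) :=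
    ((MeasurePreserving.id P).prod measurePreserving_snd).quasiMeasurePreserving
  have c1 : (fun z : Ω × Ω ↦ pathDist X z.1 z.2 ^ β * pathDist Y z.1 z.2 ^ β) =ᵐ[P.prod P]
      fun z ↦ ‖ξ z.1 - ξ z.2‖ ^ β * ‖η z.1 - η z.2‖ ^ β := by
    filter_upwards [hdX, hdY] with z h₁ h₂
    rw [h₁, h₂]
  have c2 : (fun z : Ω × Ω × Ω ↦ pathDist X z.1 z.2.1 ^ β * pathDist Y z.1 z.2.2 ^ β)
      =ᵐ[P.prod (P.prod P)] fun z ↦ ‖ξ z.1 - ξ z.2.1‖ ^ β * ‖η z.1 - η z.2.2‖ ^ β := by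
    filter_upwards [p1.ae hdX, p2.ae hdY] with z h₁ h₂
    rw [show pathDist X z.1 z.2.1 = _ from h₁, show pathDist Y z.1 z.2.2 = _ from h₂]
    rfl
  have c3 : ∫ z : Ω × Ω, pathDist X z.1 z.2 ^ β ∂(P.prod P) =
      ∫ z : Ω × Ω, ‖ξ z.1 - ξ z.2‖ ^ β ∂(P.prod P) := by
    refine integral_congr_ae ?_
    filter_upwards [hdX] with z h
    rw [h]
  have c4 : ∫ z : Ω × Ω, pathDist Y z.1 z.2 ^ β ∂(P.prod P) =
      ∫ z : Ω × Ω, ‖η z.1 - η z.2‖ ^ β ∂(P.prod P) := by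
    refine integral_congr_ae ?_
    filter_upwards [hdY] with z h
    rw [h]
  have iξ : Integrable (fun z : Ω × Ω ↦ ‖ξ z.1 - ξ z.2‖ ^ β) (P.prod P) := by
    refine integrable_norm_sub_rpow hβ0.le hξ (hXβ.congr ?_)
    filter_upwards [eX, hX.memLp] with ω h₁ h₂
    rw [← h₁, norm_pathLp h₂]
  have iη : Integrable (fun z : Ω × Ω ↦ ‖η z.1 - η z.2‖ ^ β) (P.prod P) := by
    refine integrable_norm_sub_rpow hβ0.le hη (hYβ.congr ?_)
    filter_upwards [eY, hY.memLp] with ω h₁ h₂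
    rw [← h₁, norm_pathLp h₂]
  obtain ⟨i1, I1⟩ := integrable_and_integral_kernel_mul (μ := P.prod P) hβ0 hβ2
    (A := fun z ↦ ‖ξ z.1 - ξ z.2‖) (B := fun z ↦ ‖η z.1 - η z.2‖) (by fun_prop) (by fun_prop)
    (fun _ ↦ norm_nonneg _) (fun _ ↦ norm_nonneg _) (hXY.congr c1)
  -- The product of two expectations is treated as one integral over four sample points; its
  -- integrability needs only the separate moments of `X` and `Y`.
  obtain ⟨i2, I2⟩ := integrable_and_integral_kernel_mul (μ := (P.prod P).prod (P.prod P)) hβ0 hβ2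
    (A := fun z ↦ ‖ξ z.1.1 - ξ z.1.2‖) (B := fun z ↦ ‖η z.2.1 - η z.2.2‖) (by fun_prop)
    (by fun_prop) (fun _ ↦ norm_nonneg _) (fun _ ↦ norm_nonneg _) (iξ.mul_prod iη)
  obtain ⟨i3, I3⟩ := integrable_and_integral_kernel_mul (μ := P.prod (P.prod P)) hβ0 hβ2
    (A := fun z ↦ ‖ξ z.1 - ξ z.2.1‖) (B := fun z ↦ ‖η z.1 - η z.2.2‖) (by fun_prop)
    (by fun_prop) (fun _ ↦ norm_nonneg _) (fun _ ↦ norm_nonneg _) (hXYY.congr c2)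
  have I2' : ∫ z : (Ω × Ω) × (Ω × Ω), ‖ξ z.1.1 - ξ z.1.2‖ ^ β * ‖η z.2.1 - η z.2.2‖ ^ β
      ∂((P.prod P).prod (P.prod P)) = (∫ z : Ω × Ω, ‖ξ z.1 - ξ z.2‖ ^ β ∂(P.prod P)) *
        ∫ z : Ω × Ω, ‖η z.1 - η z.2‖ ^ β ∂(P.prod P) :=
    integral_prod_mul (fun z : Ω × Ω ↦ ‖ξ z.1 - ξ z.2‖ ^ β) fun z : Ω × Ω ↦ ‖η z.1 - η z.2‖ ^ β
  have key (p : ℝ × ℝ) := condDiffSq_eq hX hY hB₁ hB₂ hB hXYB hY' hY'ind hξ hη hη' hind hlaw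
    eX eY eY' p.1 p.2
  refine ⟨integrable_c0Integrand hβ0 hβ2, ?_, ?_⟩
  · refine ((i1.add i2).sub (i3.const_mul 2)).congr (ae_of_all _ fun p ↦ ?_)
    simp only [key, Pi.add_apply, Pi.sub_apply]
    ring
  · calc c0 β ^ 2 * distCov P β X Y = _ := ?_
      _ = _ := (integral_sub (i1.add i2) (i3.const_mul 2)).symm
      _ = _ := ?_
    · simp only [Pi.add_apply]
      rw [integral_add i1 i2, integral_const_mul, I1, I2, I3, I2', distCov, integral_congr_ae c1,
        integral_congr_ae c2, c3, c4]
      ring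
    · refine integral_congr_ae (ae_of_all _ fun p ↦ ?_)
      simp only [key, Pi.add_apply]
      ring
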